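/- Let $\mathcal C$ be a semi-abelian category (pointed, Barr-exact, protomodular, with binary coproducts) and $B$ an object of $\mathcal C$. For an object $X$, let $\kappa_{B,X}\colon B\flat X\to B+X$ be the kernel of $[1,0]\colon B+X\to B$. Let $\mathbf{PXMod}_B(\mathcal C)$ be the category of internal pre-crossed modules over $B$: triples $(X,\delta,\xi)$ with $\delta\colon X\to B$ and $\xi\colon B\flat X\to X$ an internal action (an algebra for the monad $B\flat(-)$) such that $\delta\xi=\chi(1\flat\delta)$, where $\chi=[1,1]\kappa_{B,B}\colon B\flat B\to B$ is the conjugation action; morphisms are the equivariant arrows over $B$. For $X,Y$ in $\mathbf{PXMod}_B(\mathcal C)$, let $X+_{PX}Y$ be their coproduct there. Let $j\colon X\to X\rtimes Y$, $i\colon Y\to X\rtimes Y$ be the semidirect product for the action $\xi_X(\delta_Y\flat 1)$ of $Y$ on $X$, that is, the pushout of $\kappa_{Y,X}$ along this action. It is a pre-crossed module over $B$ with $\delta j=\delta_X$, $\delta i=\delta_Y$; the $B$-action on $X\rtimes Y=(X\rtimes B)\times_BY$ is induced by $\xi_Y$ on $Y$ and by conjugation of $B$ on $X\rtimes B$. Let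 $X\diamond Y$ be the join, in $\mathbf{PXMod}_B(\mathcal C)$, of the kernels of the canonical morphisms from $X+_{PX}Y$ to $X\rtimes Y$ and to $Y\rtimes X$. For monomorphisms $m\colon X\to A$, $n\colon Y\to A$ in $\mathbf{PXMod}_B(\mathcal C)$, the Peiffer commutator $\langle X,Y\rangle\le A$ is the regular image of $X\diamond Y$ under $[m,n]\colon X+_{PX}Y\to A$. The following hold in $\mathbf{PXMod}_B(\mathcal C)$. (0) Every morphism has a (regular epi, mono) factorization, and for all monomorphisms $m\colon X\to A$, $n\colon Y\to A$ the Peiffer commutator $\langle X,Y\rangle$ exists and is unique as a subobject of $A$. (1) Let $m\colon X\to A$, $n\colon Y\to A$, $m'\colon X'\to A'$, $n'\colon Y'\to A'$ be monomorphisms and $f\colon X\to X'$, $g\colon Y\to Y'$, $h\colon A\to A'$ morphisms with $hm=m'f$ and $hn=n'g$. Let $f(X)\le X'$ and $g(Y)\le Y'$ be the images given by the (regular epi, mono) factorizations of $f$ and $g$, regarded as subobjects of $A'$ via $m'$ and $n'$. Then $h$ restricts to a morphism $\langle f,g\rangle\colon\langle X,Y\rangle\to\langle X',Y'\rangle$,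 and it factors as a regular epimorphism $\langle X,Y\rangle\to\langle f(X),g(Y)\rangle$ followed by a monomorphism $\langle f(X),g(Y)\rangle\to\langle X',Y'\rangle$ that commutes with the inclusions into $A'$. (2) If $X\le X'$ and $Y\le Y'$ are subobjects of $A$, then $\langle X,Y\rangle\le\langle X',Y'\rangle$. (3) If $X$ and $Y$ are subobjects of $A$, then the inclusion $\langle X,Y\rangle\to A$ has a cokernel (its pushout along the morphism from $\langle X,Y\rangle$ to the initial object of $\mathbf{PXMod}_B(\mathcal C)$), and for every such cokernel $q\colon A\to E$, the Peiffer commutator $\langle q(X),q(Y)\rangle$ of the images of $X$ and $Y$ in $E$ is $0$. -/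

import Mathlib

open CategoryTheory CategoryTheory.Limits

universe v u

noncomputable section

/-- A semi-abelian category in the sense of Janelidze, Márki and Tholen: a pointed, Barr-exact
and Bourn-protomodular category with binary coproducts. In the presence of a zero object,
protomodularity is the split short five lemma. -/
class SemiAbelian (C : Type u) [Category.{v} C] [HasZeroMorphisms C] : Prop
    extends Regular C where
  hasZeroObject : HasZeroObject C
  hasBinaryCoproducts : HasBinaryCoproducts C
  /-- Every internal equivalence relation is a kernel pair. -/
  exact {R X : C} (p₁ p₂ : R ⟶ X) :
    IsEquivalenceRelation p₁ p₂ → ∃ (Z : C) (π : X ⟶ Z), IsKernelPair π p₁ p₂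
  /-- The split short five lemma. -/
  splitShortFive {K A D K' A' D' : C} {k : K ⟶ A} {p : A ⟶ D} {s : D ⟶ A}
    {k' : K' ⟶ A'} {p' : A' ⟶ D'} {s' : D' ⟶ A'} (hs : s ≫ p = 𝟙 D) (hs' : s' ≫ p' = 𝟙 D')
    (hk : k ≫ p = 0) (hk' : k' ≫ p' = 0)
    (_ : IsLimit (KernelFork.ofι k hk)) (_ : IsLimit (KernelFork.ofι k' hk'))
    (x : K ⟶ K') (y : A ⟶ A') (z : D ⟶ D')
    (_ : k ≫ y = x ≫ k') (_ : p ≫ z = y ≫ p') (_ : s ≫ y = z ≫ s') :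
    IsIso x → IsIso z → IsIso y

attribute [instance] SemiAbelian.hasZeroObject SemiAbelian.hasBinaryCoproducts

namespace PreCrossed

section Flat

variable {C : Type u} [Category.{v} C] [HasZeroMorphisms C] [HasBinaryCoproducts C] [HasKernels C]

/-- `B ♭ X`, the kernel of `[1, 0] : B + X ⟶ B`. -/
def flat (B X : C) : C := kernel (coprod.desc (𝟙 B) (0 : X ⟶ B))

/-- The inclusion `κ : B ♭ X ⟶ B + X`. -/
def kappa (B X : C) : flat B X ⟶ B ⨿ X := kernel.ι (coprod.desc (𝟙 B) (0 : X ⟶ B))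

instance (B X : C) : Mono (kappa B X) := 
  inferInstanceAs (Mono (kernel.ι _))

@[simp]
lemma kappa_desc (B X : C) : kappa B X ≫ coprod.desc (𝟙 B) (0 : X ⟶ B) = 0 :=
  kernel.condition _

lemma kappa_desc_assoc (B X : C) {Z : C} (h : B ⟶ Z) :
    kappa B X ≫ coprod.desc (𝟙 B) (0 : X ⟶ B) ≫ h = 0 ≫ h := by
  rw [← Category.assoc, kappa_desc]

/-- The universal property of `B ♭ X`. -/
def flatLift {B X Z : C} (t : Z ⟶ B ⨿ X) (ht : t ≫ coprod.desc (𝟙 B) (0 : X ⟶ B) = 0) :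
    Z ⟶ flat B X := kernel.lift _ t ht

@[simp]
lemma flatLift_kappa {B X Z : C} (t : Z ⟶ B ⨿ X)
    (ht : t ≫ coprod.desc (𝟙 B) (0 : X ⟶ B) = 0) : flatLift t ht ≫ kappa B X = t :=
  kernel.lift_ι _ _ _

/-- `b ♭ x : B ♭ X ⟶ B' ♭ X'`, the restriction of `b + x`. -/
def flatMap {B B' X X' : C} (b : B ⟶ B') (x : X ⟶ X') : flat B X ⟶ flat B' X' :=
  flatLift (kappa B X ≫ coprod.map b x) (by
    have : coprod.map b x ≫ coprod.desc (𝟙 B') (0 : X' ⟶ B') =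
        coprod.desc (𝟙 B) (0 : X ⟶ B) ≫ b := by
      ext <;> simp
    rw [Category.assoc, this, kappa_desc_assoc, zero_comp])

@[simp]
lemma flatMap_kappa {B B' X X' : C} (b : B ⟶ B') (x : X ⟶ X') :
    flatMap b x ≫ kappa B' X' = kappa B X ≫ coprod.map b x :=
  flatLift_kappa _ _

@[simp]
lemma flatMap_kappa_assoc {B B' X X' Z : C} (b : B ⟶ B') (x : X ⟶ X') (h : B' ⨿ X' ⟶ Z) :
    flatMap b x ≫ kappa B' X' ≫ h = kappa B X ≫ coprod.map b x ≫ h := by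
  rw [← Category.assoc, flatMap_kappa, Category.assoc]

/-- The unit `X ⟶ B ♭ X`. -/
def flatUnit (B X : C) : X ⟶ flat B X := flatLift coprod.inr (by rw [coprod.inr_desc])

@[simp]
lemma flatUnit_kappa (B X : C) : flatUnit B X ≫ kappa B X = coprod.inr := flatLift_kappa _ _

@[simp]
lemma flatUnit_kappa_assoc (B X : C) {Z : C} (h : B ⨿ X ⟶ Z) :
    flatUnit B X ≫ kappa B X ≫ h = coprod.inr ≫ h := by
  rw [← Category.assoc, flatUnit_kappa]

/-- The multiplication `B ♭ (B ♭ X) ⟶ B ♭ X`, the restriction of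
`[inl, κ] : B + (B ♭ X) ⟶ B + X`. -/
def flatMul (B X : C) : flat B (flat B X) ⟶ flat B X :=
  flatLift (kappa B (flat B X) ≫ coprod.desc coprod.inl (kappa B X)) (by
    have : coprod.desc coprod.inl (kappa B X) ≫ coprod.desc (𝟙 B) (0 : X ⟶ B) =
        coprod.desc (𝟙 B) (0 : flat B X ⟶ B) := by
      apply coprod.hom_ext
      · rw [coprod.inl_desc, ← Category.assoc, coprod.inl_desc, coprod.inl_desc]
      · rw [coprod.inr_desc, ← Category.assoc, coprod.inr_desc, kappa_desc]
    rw [Category.assoc, this, kappa_desc])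

@[simp]
lemma flatMul_kappa (B X : C) : flatMul B X ≫ kappa B X =
    kappa B (flat B X) ≫ coprod.desc coprod.inl (kappa B X) := flatLift_kappa _ _

@[simp]
lemma flatMul_kappa_assoc (B X : C) {Z : C} (h : B ⨿ X ⟶ Z) :
    flatMul B X ≫ kappa B X ≫ h =
      kappa B (flat B X) ≫ coprod.desc coprod.inl (kappa B X) ≫ h := by
  rw [← Category.assoc, flatMul_kappa, Category.assoc]

/-- The functor `B ♭ (-)`. -/
def flatFunctor (B : C) : C ⥤ C where
  obj X := flat B X
  map f := flatMap (𝟙 B) f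
  map_id X := by simp [← cancel_mono (kappa B X)]
  map_comp f g := by
    rw [← cancel_mono (kappa _ _)]
    simp

/-- The monad `B ♭ (-)`, whose algebras are the internal actions of `B`. -/
def flatMonad (B : C) : Monad C where
  toFunctor := flatFunctor B
  η :=
    { app := fun X => flatUnit B X
      naturality := fun X Y f => by
        change f ≫ flatUnit B Y = flatUnit B X ≫ flatMap (𝟙 B) f
        rw [← cancel_mono (kappa _ _)]
        simp }
  μ :=
    { app := fun X => flatMul B X
      naturality := fun X Y f => by
        change flatMap (𝟙 B) (flatMap (𝟙 B) f) ≫ flatMul B Y = flatMul B X ≫ flatMap (𝟙 B) f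
        rw [← cancel_mono (kappa _ _)]
        simp only [Category.assoc, flatMul_kappa, flatMap_kappa_assoc, flatMul_kappa_assoc,
          flatMap_kappa]
        congr 1
        ext <;> simp }
  assoc X := by
    change flatMap (𝟙 B) (flatMul B X) ≫ flatMul B X = flatMul B (flat B X) ≫ flatMul B X
    rw [← cancel_mono (kappa _ _)]
    simp only [Category.assoc, flatMul_kappa, flatMap_kappa_assoc, flatMul_kappa_assoc]
    congr 1
    ext <;> simp [coprod.inl_desc, coprod.inr_desc]
  left_unit X := by
    change flatUnit B (flat B X) ≫ flatMul B X = 𝟙 (flat B X)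
    rw [← cancel_mono (kappa _ _)]
    simp [coprod.inr_desc]
  right_unit X := by
    change flatMap (𝟙 B) (flatUnit B X) ≫ flatMul B X = 𝟙 (flat B X)
    rw [← cancel_mono (kappa _ _)]
    simp only [Category.assoc, flatMul_kappa, flatMap_kappa_assoc, Category.id_comp]
    conv_rhs => rw [← Category.comp_id (kappa B X)]
    congr 1
    ext <;> simp

/-- The conjugation action `χ : B ♭ B ⟶ B`, the restriction of `[1, 1] : B + B ⟶ B`. -/
def conj (B : C) : flat B B ⟶ B := kappa B B ≫ coprod.desc (𝟙 B) (𝟙 B)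

/-- An arrow `ξ : B ♭ X ⟶ X` is given. `S`, with `j : X ⟶ S` and `i : B ⟶ S`, is the semidirect
product of `X` and `B` with respect to `ξ`: the universal quotient of `B + X` in which `ξ`
becomes conjugation, that is, the pushout of `κ` along `ξ`. -/
def IsSemidirect {B X S : C} (ξ : flat B X ⟶ X) (j : X ⟶ S) (i : B ⟶ S) : Prop :=
  IsPushout ξ (kappa B X) j (coprod.desc i j)

end Flat

variable {C : Type u} [Category.{v} C] [HasZeroMorphisms C] [SemiAbelian C]

/-- An internal pre-crossed module over `B`: an object `X` with an internal action
`ξ : B ♭ X ⟶ X` of `B` (an algebra for the monad `B ♭ (-)`) and an arrow `δ : X ⟶ B` that is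
equivariant for `ξ` and the conjugation action of `B`. -/
structure PXMod (B : C) where
  alg : (flatMonad B).Algebra
  δ : alg.A ⟶ B
  equivariant : flatMap (𝟙 B) δ ≫ conj B = (show flat B alg.A ⟶ alg.A from alg.a) ≫ δ

namespace PXMod

variable {B : C}

/-- The underlying object. -/
abbrev obj (X : PXMod B) : C := X.alg.A

/-- The action `ξ : B ♭ X ⟶ X`. -/
abbrev act (X : PXMod B) : flat B X.obj ⟶ X.obj := X.alg.a

/-- A morphism of pre-crossed modules over `B`: an equivariant arrow over `B`. -/
@[ext]
structure Hom (X Y : PXMod B) where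
  hom : X.obj ⟶ Y.obj
  act_hom : flatMap (𝟙 B) hom ≫ Y.act = X.act ≫ hom
  hom_δ : hom ≫ Y.δ = X.δ

instance : Category (PXMod B) where
  Hom X Y := Hom X Y
  id X :=
    { hom := 𝟙 X.obj
      act_hom := by
        have : flatMap (𝟙 B) (𝟙 X.obj) = 𝟙 (flat B X.obj) := (flatFunctor B).map_id X.obj
        rw [this, Category.id_comp, Category.comp_id]
      hom_δ := Category.id_comp _ }
  comp {X Y Z} f g :=
    { hom := f.hom ≫ g.hom
      act_hom := by
        have : flatMap (𝟙 B) (f.hom ≫ g.hom) = flatMap (𝟙 B) f.hom ≫ flatMap (𝟙 B) g.hom :=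
          (flatFunctor B).map_comp f.hom g.hom
        rw [this, Category.assoc, g.act_hom, ← Category.assoc, f.act_hom, Category.assoc]
      hom_δ := by rw [Category.assoc, g.hom_δ, f.hom_δ] }
  id_comp f := Hom.ext (Category.id_comp _)
  comp_id f := Hom.ext (Category.comp_id _)
  assoc f g h := Hom.ext (Category.assoc _ _ _)

end PXMod

variable {B : C}

/-- The semidirect product `X ⋊ Y` of two pre-crossed modules over `B`, as a pre-crossed module
over `B`. Here `Y` acts on `X` by `Y ♭ X ⟶ B ♭ X ⟶ X`, and `T` is the semidirect product `X ⋊ B`.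
The square formed by `p : X ⋊ Y ⟶ Y`, `t = 1 ⋊ δ_Y : X ⋊ Y ⟶ X ⋊ B`, `δ_Y` and `X ⋊ B ⟶ B` is a
pullback, and the action of `B` on `X ⋊ Y` is induced by the action of `B` on `Y` and the
conjugation action of `B` on `X ⋊ B` (`act_p` and `act_t`). The arrow `S.δ` is `[δ_X, δ_Y⟩`,
because `j` and `i` are morphisms over `B`. -/
structure SemidirectProduct (X Y : PXMod B) where
  T : C
  jT : X.obj ⟶ T
  iT : B ⟶ T
  isSemidirect_T : IsSemidirect X.act jT iT
  S : PXMod B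
  j : X ⟶ S
  i : Y ⟶ S
  isSemidirect_S : IsSemidirect (flatMap Y.δ (𝟙 X.obj) ≫ X.act) j.hom i.hom
  p : S.obj ⟶ Y.obj
  j_p : j.hom ≫ p = 0
  i_p : i.hom ≫ p = 𝟙 Y.obj
  t : S.obj ⟶ T
  j_t : j.hom ≫ t = jT
  i_t : i.hom ≫ t = Y.δ ≫ iT
  act_p : S.act ≫ p = flatMap (𝟙 B) p ≫ Y.act
  act_t : S.act ≫ t = flatMap iT t ≫ conj T

/-- The subobject `K` of `W` in pre-crossed modules is the kernel of `f`, as computed in `C`. -/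
def IsKernel {W S : PXMod B} (f : W ⟶ S) (K : Subobject W) : Prop :=
  ∃ w : K.arrow.hom ≫ f.hom = 0, Nonempty (IsLimit (KernelFork.ofι K.arrow.hom w))

/-- Let `(W, inl, inr)` be the coproduct of `X` and `Y` in pre-crossed modules over `B`. The
subobject `D` of `W` is the join, in pre-crossed modules, of the kernels of the two canonical
morphisms from `W` to `X ⋊ Y` and to `Y ⋊ X`. -/
def IsPeifferJoin {X Y W : PXMod B} {inl : X ⟶ W} {inr : Y ⟶ W}
    (hW : IsColimit (BinaryCofan.mk inl inr)) (D : Subobject W) : Prop :=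
  ∃ (S : SemidirectProduct X Y) (S' : SemidirectProduct Y X) (K K' : Subobject W),
    IsKernel (hW.desc (BinaryCofan.mk S.j S.i)) K ∧
    IsKernel (hW.desc (BinaryCofan.mk S'.i S'.j)) K' ∧
    IsLUB {K, K'} D

/-- The subobject `Q` of `A` is the Peiffer commutator of `m : X ⟶ A` and `n : Y ⟶ A`: the
regular image, under `[m, n]` from the coproduct of `X` and `Y` to `A`, of the join of the two
kernels. -/
def IsPeifferCommutator {X Y A : PXMod B} (m : X ⟶ A) (n : Y ⟶ A) (Q : Subobject A) : Prop :=
  ∃ (W : PXMod B) (inl : X ⟶ W) (inr : Y ⟶ W) (hW : IsColimit (BinaryCofan.mk inl inr))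
    (D : Subobject W) (r : (D : PXMod B) ⟶ (Q : PXMod B)),
    IsPeifferJoin hW D ∧ IsRegularEpi r ∧
      r ≫ Q.arrow = D.arrow ≫ hW.desc (BinaryCofan.mk m n)

/-- `f = e ≫ i` is a (regular epi, mono) factorization. -/
structure IsImageFactorization {X I Y : PXMod B} (f : X ⟶ Y) (e : X ⟶ I) (i : I ⟶ Y) : Prop where
  regularEpi : IsRegularEpi e
  mono : Mono i
  fac : e ≫ i = f

/-- `q` is the cokernel of `k` in pre-crossed modules over `B`: the pushout of `k` along a
morphism to the initial object. -/
def IsCokernel {Q A E : PXMod B} (k : Q ⟶ A) (q : A ⟶ E) : Prop :=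
  ∃ (Z : PXMod B) (_ : IsInitial Z) (t : Q ⟶ Z) (z : Z ⟶ E), IsPushout k t q z

end PreCrossed

end

/-!
Write `X ⋄ Y ≤ X + Y` for the join of the kernels of `X + Y ⟶ X ⋊ Y` and `X + Y ⟶ Y ⋊ X`. All the
claims follow from one property of the Peiffer commutator: it is functorial in the pair `(m, n)`,
and the induced morphism is a regular epimorphism as soon as `f` and `g` are
(`IsPeifferCommutator.exists_map`). Commutators are images of the objects `X ⋄ Y`, so this reduces
to the statement that `X ⋄ Y ⟶ X₁ ⋄ Y₁` is a regular epimorphism for regular epimorphisms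
`X ⟶ X₁` and `Y ⟶ Y₁`, hence to the same statement for the two kernels. That is a variant of the
3 × 3 lemma (`isRegularEpi_of_isSplitExtension`): the kernel of `X ⋊ Y ⟶ X₁ ⋊ Y₁` is generated by
the kernels of `X ⟶ X₁` and `Y ⟶ Y₁`, both of which come from the kernel of `X + Y ⟶ X₁ + Y₁`.

To make sense of the objects involved, coproducts, pushouts and images of pre-crossed modules are
needed. Images and kernels are computed in `C`, since `B ♭ (-)` preserves regular epimorphisms. For
the colimits, an action `ξ : B ♭ X ⟶ X` is realized by a split extension of `B` with kernel `X`
(`exists_isSplitExtension`), which is the pushout of `κ` along `ξ`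
(`IsSplitExtension.isSemidirect`). It follows that pre-crossed modules over `B` are equivalent to
reflexive graphs over `B`, whose pushouts are pushouts in `C`. The existence of the latter is
deduced from exactness and from the fact that every reflexive relation in a semi-abelian category is
an equivalence relation (`isEquivalenceRelation_of_reflexive`).

The semidirect product of pre-crossed modules is first constructed as a pullback
(`exists_semidirectProduct`); since the definition makes it a pushout, every semidirect product has
the properties of this one, and `X ⋊ Y` is functorial (`SemidirectProduct.exists_map`).
-/

noncomputable section

attribute [local simp] pullback.lift_fst pullback.lift_fst_assoc pullback.lift_snd
  pullback.lift_snd_assoc prod.lift_fst prod.lift_fst_assoc prod.lift_snd prod.lift_snd_assoc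
  coprod.inl_desc coprod.inl_desc_assoc coprod.inr_desc coprod.inr_desc_assoc

/-! ### Kernels, protomodularity and colimits in semi-abelian categories -/

namespace PreCrossed

section Kernels

variable {C : Type u} [Category.{v} C] [HasZeroMorphisms C]

/-- `k` is a kernel of `p`. This is `IsLimit (KernelFork.ofι k _)` stated as a proposition on
elements, which is easier to check and to use. -/
structure IsKer {K A D : C} (k : K ⟶ A) (p : A ⟶ D) : Prop where
  zero : k ≫ p = 0
  mono : Mono k
  exists_lift : ∀ {Z : C} (t : Z ⟶ A), t ≫ p = 0 → ∃ u : Z ⟶ K, u ≫ k = t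

namespace IsKer

variable {K A D : C} {k : K ⟶ A} {p : A ⟶ D}

lemma nonempty_isLimit (h : IsKer k p) : Nonempty (IsLimit (KernelFork.ofι k h.zero)) := by
  have := h.mono
  exact ⟨KernelFork.IsLimit.ofι' k h.zero fun t ht =>
    ⟨(h.exists_lift t ht).choose, (h.exists_lift t ht).choose_spec⟩⟩

lemma of_isLimit {w : k ≫ p = 0} (h : IsLimit (KernelFork.ofι k w)) : IsKer k p where
  zero := w
  mono := Fork.IsLimit.mono h
  exists_lift t ht := ⟨(KernelFork.IsLimit.lift' h t ht).1, (KernelFork.IsLimit.lift' h t ht).2⟩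

lemma kernel_ι [HasKernels C] (p : A ⟶ D) : IsKer (kernel.ι p) p :=
  .of_isLimit (w := kernel.condition p) (kernelIsKernel p)

end IsKer

/-- `k : K ⟶ A` is the kernel of the split epimorphism `p : A ⟶ D` with section `s`. -/
structure IsSplitExtension {K A D : C} (k : K ⟶ A) (p : A ⟶ D) (s : D ⟶ A) : Prop
    extends IsKer k p where
  section_comp : s ≫ p = 𝟙 D

end Kernels

variable {C : Type u} [Category.{v} C] [HasZeroMorphisms C] [SemiAbelian C]

section Regular

lemma strongEpi_of_factors {A B : C} {f : A ⟶ B}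
    (h : ∀ ⦃Z : C⦄ (p : A ⟶ Z) (i : Z ⟶ B) (_ : p ≫ i = f) [Mono i], IsIso i) : StrongEpi f :=
  (extremalEpi_iff_strongEpi_of_hasPullbacks f).1 (.mk_of_hasEqualizers f h)

lemma exists_regularEpi_mono {A B : C} (f : A ⟶ B) :
    ∃ (I : C) (e : A ⟶ I) (m : I ⟶ B), IsRegularEpi e ∧ Mono m ∧ e ≫ m = f :=
  let F := Regular.strongEpiMonoFactorisation f
  ⟨F.I, F.e, F.m, inferInstance, inferInstance, F.fac⟩

lemma isRegularEpi_of_isPullback {P X Y Z : C} {a : P ⟶ X} {b : P ⟶ Y} {f : X ⟶ Z} {g : Y ⟶ Z}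
    (h : IsPullback a b f g) [hg : IsRegularEpi g] : IsRegularEpi a :=
  Regular.regularEpiIsStableUnderBaseChange.of_isPullback h.flip hg

/-- A regular epimorphism restricts to a regular epimorphism between the kernels of two morphisms
into the same object. -/
lemma isRegularEpi_of_isKer {K A K' A' D : C} {k : K ⟶ A} {p : A ⟶ D} {k' : K' ⟶ A'}
    {p' : A' ⟶ D} (h : IsKer k p) (h' : IsKer k' p') {u : K ⟶ K'} {f : A ⟶ A'}
    (hu : u ≫ k' = k ≫ f) (hf : f ≫ p' = p) [IsRegularEpi f] : IsRegularEpi u := by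
  have := h.mono
  have := h'.mono
  refine isRegularEpi_of_isPullback (b := k) (f := k') (g := f) ⟨⟨hu⟩, ⟨PullbackCone.IsLimit.mk _
    (fun s => (h.exists_lift s.snd (by
      rw [← hf, ← Category.assoc, ← s.condition, Category.assoc, h'.zero, comp_zero])).choose)
    (fun s => ?_) (fun s => ?_) (fun s m h₁ h₂ => ?_)⟩⟩
  all_goals generalize_proofs hs
  · rw [← cancel_mono k', Category.assoc, hu, ← Category.assoc, hs.choose_spec, s.condition]
  · exact hs.choose_spec
  · rw [← cancel_mono k, h₂, hs.choose_spec]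

end Regular

section Protomodular

namespace IsSplitExtension

variable {K A D : C} {k : K ⟶ A} {p : A ⟶ D} {s : D ⟶ A}

/-- The section and the kernel of a split epimorphism are jointly extremally epic. -/
lemma isIso_of_mono (h : IsSplitExtension k p s) {M : C} (m : M ⟶ A) [Mono m]
    (k₁ : K ⟶ M) (s₁ : D ⟶ M) (hk : k₁ ≫ m = k) (hs : s₁ ≫ m = s) : IsIso m := by
  have := h.mono
  have h₁ : IsKer k₁ (m ≫ p) :=
    { zero := by rw [← Category.assoc, hk, h.zero]
      mono := by
        have : Mono (k₁ ≫ m) := hk ▸ h.mono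
        exact mono_of_mono k₁ m
      exists_lift := fun t ht => by
        obtain ⟨u, hu⟩ := h.exists_lift (t ≫ m) (by rw [Category.assoc, ht])
        exact ⟨u, by rw [← cancel_mono m, Category.assoc, hk, hu]⟩ }
  exact SemiAbelian.splitShortFive (s := s₁) (s' := s) (k := k₁) (k' := k) (p := m ≫ p) (p' := p)
    (by rw [← Category.assoc, hs, h.section_comp]) h.section_comp h₁.zero h.zero
    h₁.nonempty_isLimit.some h.nonempty_isLimit.some (𝟙 K) m (𝟙 D) (by simp [hk]) (by simp)
    (by simp [hs]) inferInstance inferInstance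

lemma isRegularEpi_desc (h : IsSplitExtension k p s) : IsRegularEpi (coprod.desc s k) := by
  have : StrongEpi (coprod.desc s k) := strongEpi_of_factors fun Z a i hi _ =>
    h.isIso_of_mono i (coprod.inr ≫ a) (coprod.inl ≫ a) (by simp [hi]) (by simp [hi])
  infer_instance

lemma hom_ext (h : IsSplitExtension k p s) {Z : C} {f g : A ⟶ Z} (hk : k ≫ f = k ≫ g)
    (hs : s ≫ f = s ≫ g) : f = g := by
  have := h.isRegularEpi_desc
  rw [← cancel_epi (coprod.desc s k)]
  ext <;> simp [hk, hs]

end IsSplitExtension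

/-- A subobject containing the kernel of `p` and mapped onto the codomain of `p` is everything.
Pulled back along the regular epimorphism `m ≫ p`, this becomes a statement on split
epimorphisms. -/
lemma isIso_of_isKer_of_isRegularEpi {K A D M : C} {k : K ⟶ A} {p : A ⟶ D} (h : IsKer k p)
    (m : M ⟶ A) [Mono m] [IsRegularEpi (m ≫ p)] (k₁ : K ⟶ M) (hk : k₁ ≫ m = k) : IsIso m := by
  have := h.mono
  have hsplit : IsSplitExtension (pullback.lift (f := m ≫ p) (g := p) 0 k (by simp [h.zero]))
      (pullback.fst (m ≫ p) p) (pullback.lift (𝟙 M) m (by simp)) :=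
    { zero := by simp
      mono := by
        refine ⟨fun a b hab => ?_⟩
        rw [← cancel_mono k]
        simpa using hab =≫ pullback.snd _ _
      exists_lift := fun t ht => by
        obtain ⟨u, hu⟩ := h.exists_lift (t ≫ pullback.snd _ _) (by
          rw [Category.assoc, ← pullback.condition, ← Category.assoc, ht, zero_comp])
        exact ⟨u, by ext <;> simp [hu, ht]⟩
      section_comp := by simp }
  let n : pullback (m ≫ p) (m ≫ p) ⟶ pullback (m ≫ p) p :=
    pullback.lift (pullback.fst _ _) (pullback.snd _ _ ≫ m) (by simp [pullback.condition])
  have : Mono n := ⟨fun a b hab => by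
    apply pullback.hom_ext
    · simpa [n] using hab =≫ pullback.fst _ _
    · rw [← cancel_mono m]
      simpa [n] using hab =≫ pullback.snd _ _⟩
  have : IsIso n := hsplit.isIso_of_mono n
    (pullback.lift 0 k₁ (by rw [zero_comp, ← Category.assoc, hk, h.zero]))
    (pullback.lift (𝟙 M) (𝟙 M) rfl) (by ext <;> simp [n, hk]) (by ext <;> simp [n])
  have hn : (inv n ≫ pullback.snd (m ≫ p) (m ≫ p)) ≫ m = pullback.snd (m ≫ p) p := by
    rw [Category.assoc, IsIso.inv_comp_eq]
    simp [n]
  have : StrongEpi ((inv n ≫ pullback.snd (m ≫ p) (m ≫ p)) ≫ m) := by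
    rw [hn]; infer_instance
  have := strongEpi_of_strongEpi (inv n ≫ pullback.snd (m ≫ p) (m ≫ p)) m
  exact isIso_of_mono_of_strongEpi m

end Protomodular

section Malcev

/-- The two canonical morphisms into a pullback of split epimorphisms are jointly extremally
epic. -/
lemma isIso_of_mono_pullback {A A' D M : C} {f : A ⟶ D} {s : D ⟶ A} (hs : s ≫ f = 𝟙 D)
    {g : A' ⟶ D} {t : D ⟶ A'} (ht : t ≫ g = 𝟙 D) (m : M ⟶ pullback f g) [Mono m]
    (a : A ⟶ M) (ha : a ≫ m = pullback.lift (𝟙 A) (f ≫ t) (by simp [ht]))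
    (a' : A' ⟶ M) (ha' : a' ≫ m = pullback.lift (g ≫ s) (𝟙 A') (by simp [hs])) : IsIso m := by
  have h : IsSplitExtension (pullback.lift (f := f) 0 (kernel.ι g) (by simp)) (pullback.fst f g)
      (pullback.lift (𝟙 A) (f ≫ t) (by simp [ht])) :=
    { zero := by simp
      mono := by
        refine ⟨fun a b hab => ?_⟩
        rw [← cancel_mono (kernel.ι g)]
        simpa using hab =≫ pullback.snd _ _
      exists_lift := fun u hu => by
        have hu' : (u ≫ pullback.snd _ _) ≫ g = 0 := by
          rw [Category.assoc, ← pullback.condition, ← Category.assoc, hu, zero_comp]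
        exact ⟨kernel.lift g _ hu', by ext <;> simp [hu]⟩
      section_comp := by simp }
  refine h.isIso_of_mono m (kernel.ι g ≫ a') a ?_ ha
  rw [Category.assoc, ha']
  ext <;> simp

/-- Every relation is difunctional: from `x R y`, `z R y` and `z R w` it follows that `x R w`. -/
lemma exists_difunctional {R X Y : C} {r₁ : R ⟶ X} {r₂ : R ⟶ Y} [JointlyMono₂ r₁ r₂] {Z : C}
    (a b c : Z ⟶ R) (hab : a ≫ r₂ = b ≫ r₂) (hbc : b ≫ r₁ = c ≫ r₁) :
    ∃ d : Z ⟶ R, d ≫ r₁ = a ≫ r₁ ∧ d ≫ r₂ = c ≫ r₂ := by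
  have : Mono (prod.lift r₁ r₂) := ⟨fun x y hxy => JointlyMono₂.right_cancellation (p₁ := r₁)
    (p₂ := r₂) x y (by simpa using hxy =≫ prod.fst) (by simpa using hxy =≫ prod.snd)⟩
  -- `f` projects `x R y, z R y` to `z R y`, and `g` projects `z R y, z R w` to `z R y`.
  let f := pullback.snd r₂ r₂
  let g := pullback.fst r₁ r₁
  let l : pullback f g ⟶ X ⨯ Y := prod.lift (pullback.fst f g ≫ pullback.fst r₂ r₂ ≫ r₁)
    (pullback.snd f g ≫ pullback.snd r₁ r₁ ≫ r₂)
  let m : pullback (prod.lift r₁ r₂) l ⟶ pullback f g := pullback.snd _ _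
  have : IsIso m := isIso_of_mono_pullback (s := pullback.lift (𝟙 R) (𝟙 R) rfl)
    (t := pullback.lift (𝟙 R) (𝟙 R) rfl) (by simp [f]) (by simp [g]) m
    (pullback.lift (pullback.fst r₂ r₂) (pullback.lift (𝟙 _) (f ≫ pullback.lift (𝟙 R) (𝟙 R) rfl)
      (by simp [g])) (by ext <;> simp [l, f, g, pullback.condition])) (by simp [m])
    (pullback.lift (pullback.snd r₁ r₁) (pullback.lift (g ≫ pullback.lift (𝟙 R) (𝟙 R) rfl) (𝟙 _)
      (by simp [f])) (by ext <;> simp [l, f, g, pullback.condition])) (by simp [m])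
  let q : Z ⟶ pullback f g :=
    pullback.lift (pullback.lift a b hab) (pullback.lift b c hbc) (by simp [f, g])
  have hq : (q ≫ inv m ≫ pullback.fst (prod.lift r₁ r₂) l) ≫ prod.lift r₁ r₂ = q ≫ l := by
    rw [Category.assoc, Category.assoc, pullback.condition]
    simp [m]
  exact ⟨q ≫ inv m ≫ pullback.fst (prod.lift r₁ r₂) l,
    by simpa [l, q] using hq =≫ prod.fst, by simpa [l, q] using hq =≫ prod.snd⟩

/-- Semi-abelian categories are Mal'cev: a reflexive relation is an equivalence relation. -/
lemma isEquivalenceRelation_of_reflexive {R X : C} (r₁ r₂ : R ⟶ X) [JointlyMono₂ r₁ r₂]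
    (e : X ⟶ R) (h₁ : e ≫ r₁ = 𝟙 X) (h₂ : e ≫ r₂ = 𝟙 X) : IsEquivalenceRelation r₁ r₂ := by
  -- Symmetry comes from `y R y`, `x R y`, `x R x`, transitivity from `x R y`, `y R y`, `y R z`.
  obtain ⟨s, hs₁, hs₂⟩ := exists_difunctional (r₁ := r₁) (r₂ := r₂) (r₂ ≫ e) (𝟙 R) (r₁ ≫ e)
    (by simp [h₂]) (by simp [h₁])
  obtain ⟨t, ht₁, ht₂⟩ := exists_difunctional (r₁ := r₁) (r₂ := r₂) (pullback.fst r₂ r₁)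
    (pullback.fst r₂ r₁ ≫ r₂ ≫ e) (pullback.snd r₂ r₁) (by simp [h₂])
    (by simp [h₁, pullback.condition])
  exact ⟨⟨{
    r := e
    reflexivity₁ := h₁
    reflexivity₂ := h₂
    s := s
    symmetry₁ := by simpa [h₁] using hs₁
    symmetry₂ := by simpa [h₂] using hs₂
    c := pullback.cone r₂ r₁
    isLimit := pullback.isLimit r₂ r₁
    t := t
    transitivity₁ := ht₁
    transitivity₂ := ht₂ }⟩⟩

/-- The image of a reflexive pair is the kernel pair of a regular epimorphism. -/
lemma exists_isKernelPair_of_reflexive {V U : C} (α β : V ⟶ U) (σ : U ⟶ V) (hα : σ ≫ α = 𝟙 U)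
    (hβ : σ ≫ β = 𝟙 U) : ∃ (T R : C) (π : U ⟶ T) (r₁ r₂ : R ⟶ U) (ε : V ⟶ R), IsRegularEpi π ∧
      IsKernelPair π r₁ r₂ ∧ IsRegularEpi ε ∧ ε ≫ r₁ = α ∧ ε ≫ r₂ = β := by
  obtain ⟨R, ε, m, hε, hm, fac⟩ := exists_regularEpi_mono (prod.lift α β)
  have h₁ : ε ≫ m ≫ prod.fst = α := by simpa using fac =≫ prod.fst
  have h₂ : ε ≫ m ≫ prod.snd = β := by simpa using fac =≫ prod.snd
  have : JointlyMono₂ (m ≫ prod.fst) (m ≫ prod.snd) := ⟨fun Y f g hf hg => by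
    rw [← cancel_mono m]
    ext
    · simpa using hf
    · simpa using hg⟩
  obtain ⟨Z, π, hπ⟩ := SemiAbelian.exact _ _
    (isEquivalenceRelation_of_reflexive (m ≫ prod.fst) (m ≫ prod.snd) (σ ≫ ε)
      (by rw [Category.assoc, h₁, hα]) (by rw [Category.assoc, h₂, hβ]))
  obtain ⟨T, e, n, he, hn, rfl⟩ := exists_regularEpi_mono π
  exact ⟨T, R, e, _, _, ε, he, hπ.cancel_right_of_mono, hε, h₁, h₂⟩

/-- The coequalizer of `f, g : X ⟶ Y` is that of the reflexive pair `[1, f], [1, g] : Y + X ⟶ Y`. -/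
instance : HasCoequalizers C := by
  refine @hasCoequalizers_of_hasColimit_parallelPair C _ (fun {X Y f g} => ?_)
  obtain ⟨T, R, π, r₁, r₂, ε, hπ, hk, hε, h₁, h₂⟩ := exists_isKernelPair_of_reflexive
    (coprod.desc (𝟙 Y) f) (coprod.desc (𝟙 Y) g) coprod.inl (by simp) (by simp)
  have key : ∀ {Z : C} (w : Y ⟶ Z), r₁ ≫ w = r₂ ≫ w ↔ f ≫ w = g ≫ w := fun w => by
    rw [← cancel_epi ε, ← Category.assoc, ← Category.assoc, h₁, h₂]
    refine ⟨fun h => by simpa using coprod.inr ≫= h, fun h => by ext <;> simp [h]⟩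
  have hc := hk.toCoequalizer' 
  exact ⟨⟨⟨_, Cofork.IsColimit.mk (Cofork.ofπ π ((key π).1 hk.w))
    (fun s => hc.desc (Cofork.ofπ s.π ((key s.π).2 s.condition)))
    (fun s => hc.fac (Cofork.ofπ s.π ((key s.π).2 s.condition)) .one)
    (fun s m hm => (cancel_epi π).1 (hm.trans
      (hc.fac (Cofork.ofπ s.π ((key s.π).2 s.condition)) .one).symm))⟩⟩⟩

instance : HasPushouts C := hasPushouts_of_hasBinaryCoproducts_of_hasCoequalizers C

end Malcev

end PreCrossed

/-! ### Actions and split extensions -/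

namespace PreCrossed

variable {C : Type u} [Category.{v} C] [HasZeroMorphisms C] [SemiAbelian C]

section Flat

variable {B X : C}

lemma isSplitExtension_kappa (B X : C) :
    IsSplitExtension (kappa B X) (coprod.desc (𝟙 B) (0 : X ⟶ B)) coprod.inl where
  toIsKer := .kernel_ι _
  section_comp := by simp

lemma flatMap_conj {T : C} (b : B ⟶ T) (x : X ⟶ T) :
    flatMap b x ≫ conj T = kappa B X ≫ coprod.desc b x := by
  simp [conj]

lemma flatMap_comp {B' B'' X' X'' : C} (b : B ⟶ B') (b' : B' ⟶ B'') (x : X ⟶ X') (x' : X' ⟶ X'') :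
    flatMap b x ≫ flatMap b' x' = flatMap (b ≫ b') (x ≫ x') := by
  simp [← cancel_mono (kappa _ _)]

lemma flatMap_zero {B' X' : C} (b : B ⟶ B') : flatMap b (0 : X ⟶ X') = 0 := by
  have : coprod.map b (0 : X ⟶ X') = coprod.desc (𝟙 B) (0 : X ⟶ B) ≫ b ≫ coprod.inl := by
    ext <;> simp
  rw [← cancel_mono (kappa _ _), flatMap_kappa, this, kappa_desc_assoc, zero_comp, zero_comp]

instance isRegularEpi_coprodMap {X' : C} (e : X ⟶ X') [IsRegularEpi e] :
    IsRegularEpi (coprod.map (𝟙 B) e) := by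
  have : StrongEpi (coprod.map (𝟙 B) e) := strongEpi_of_factors fun Z p i fac _ => by
    have sq : CommSq (coprod.inr ≫ p) e i coprod.inr := ⟨by simp [fac]⟩
    have h : coprod.desc (coprod.inl ≫ p) sq.lift ≫ i = 𝟙 _ := by
      ext <;> simp [fac]
    exact ⟨_, by rw [← cancel_mono i, Category.assoc, h, Category.id_comp, Category.comp_id], h⟩
  infer_instance

/-- `B ♭ (-)` preserves regular epimorphisms, because coproducts do. -/
instance isRegularEpi_flatMap {X' : C} (e : X ⟶ X') [IsRegularEpi e] :
    IsRegularEpi (flatMap (𝟙 B) e) :=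
  isRegularEpi_of_isKer (isSplitExtension_kappa B X).toIsKer (isSplitExtension_kappa B X').toIsKer
    (flatMap_kappa _ _) (by ext <;> simp)

end Flat

section Semidirect

/-- A split extension is the semidirect product for the action that it induces on the kernel. The
arrow `[i, j]` is a regular epimorphism; its kernel pair is a split extension of `B`, so that a
morphism out of it is determined on the section and on the kernel. -/
lemma IsSplitExtension.isSemidirect {B X T : C} {j : X ⟶ T} {d : T ⟶ B} {i : B ⟶ T}
    (h : IsSplitExtension j d i) {ξ : flat B X ⟶ X} (hξ : ξ ≫ j = kappa B X ≫ coprod.desc i j) :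
    IsSemidirect ξ j i := by
  have := h.mono
  have := h.isRegularEpi_desc
  have hπd : coprod.desc i j ≫ d = coprod.desc (𝟙 B) 0 := by
    ext <;> simp [h.section_comp, h.zero]
  have hη : flatUnit B X ≫ ξ = 𝟙 X := by
    rw [← cancel_mono j, Category.assoc, hξ]
    simp
  have hk := IsKernelPair.of_hasPullback (coprod.desc i j)
  -- An arrow `w` whose restriction along `κ` factors through `ξ` coequalizes the kernel pair.
  have key : ∀ {Z : C} (u : X ⟶ Z) (w : B ⨿ X ⟶ Z), ξ ≫ u = kappa B X ≫ w →
      pullback.fst (coprod.desc i j) (coprod.desc i j) ≫ w = pullback.snd _ _ ≫ w := by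
    intro Z u w huw
    have hR : IsSplitExtension
        (kernel.ι (pullback.fst (coprod.desc i j) (coprod.desc i j) ≫ coprod.desc (𝟙 B) 0))
        (pullback.fst (coprod.desc i j) (coprod.desc i j) ≫ coprod.desc (𝟙 B) 0)
        (pullback.lift coprod.inl coprod.inl rfl) :=
      { toIsKer := .kernel_ι _
        section_comp := by simp }
    refine hR.hom_ext ?_ (by simp)
    have hl := kernel.condition
      (pullback.fst (coprod.desc i j) (coprod.desc i j) ≫ coprod.desc (𝟙 B) (0 : X ⟶ B))
    obtain ⟨a, ha⟩ := (isSplitExtension_kappa B X).exists_lift (kernel.ι _ ≫ pullback.fst _ _)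
      (by rw [Category.assoc, hl])
    obtain ⟨b, hb⟩ := (isSplitExtension_kappa B X).exists_lift
      (kernel.ι (pullback.fst (coprod.desc i j) (coprod.desc i j) ≫ coprod.desc (𝟙 B) 0) ≫
        pullback.snd _ _)
      (by rw [← hπd, Category.assoc, ← pullback.condition_assoc, hπd, hl])
    have hab : a ≫ ξ = b ≫ ξ := by
      rw [← cancel_mono j, Category.assoc, Category.assoc, hξ, ← Category.assoc, ha,
        ← Category.assoc, hb, Category.assoc, Category.assoc, pullback.condition]
    rw [← Category.assoc, ← ha, ← Category.assoc, ← hb, Category.assoc, Category.assoc, ← huw,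
      ← Category.assoc, ← Category.assoc, hab]
  refine ⟨⟨hξ⟩, ⟨PushoutCocone.IsColimit.mk _
    (fun s => hk.toCoequalizer'.desc (Cofork.ofπ s.inr (key s.inl s.inr s.condition)))
    (fun s => ?_) (fun s => ?_) (fun s m h₁ h₂ => ?_)⟩⟩
  all_goals have hfac := hk.toCoequalizer'.fac
              (Cofork.ofπ s.inr (key s.inl s.inr s.condition)) .one
            dsimp at hfac
  · rw [← coprod.inr_desc_assoc i j, hfac, ← flatUnit_kappa_assoc, ← s.condition, ← Category.assoc, hη,
      Category.id_comp]
  · exact hfac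
  · rw [← cancel_epi (coprod.desc i j), hfac, h₂]

/-- An algebra for the monad `B ♭ (-)` arises from a split extension. The quotient `T` of `B + X`
by the reflexive pair `[inl, κ], 1 + ξ : B + B ♭ X ⟶ B + X` is a point over `B`. The kernel of
`T ⟶ B` is a quotient of `X`; a pair of elements of `X` identified in `T` lifts, after a cover, to
an element of `B ♭ (B ♭ X)`, and the associativity of `ξ` shows that it is trivial. -/
theorem exists_isSplitExtension {B X : C} (ξ : flat B X ⟶ X) (unit : flatUnit B X ≫ ξ = 𝟙 X)
    (assoc : flatMap (𝟙 B) ξ ≫ ξ = flatMul B X ≫ ξ) :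
    ∃ (T : C) (j : X ⟶ T) (d : T ⟶ B) (i : B ⟶ T), IsSplitExtension j d i ∧
      ξ ≫ j = kappa B X ≫ coprod.desc i j := by
  obtain ⟨T, R, π, r₁, r₂, ε, hπ, hk, hε, h₁, h₂⟩ := exists_isKernelPair_of_reflexive
    (coprod.desc coprod.inl (kappa B X)) (coprod.map (𝟙 B) ξ)
    (coprod.map (𝟙 B) (flatUnit B X)) (by ext <;> simp) (by ext <;> simp [reassoc_of% unit])
  have hr : r₁ ≫ coprod.desc (𝟙 B) (0 : X ⟶ B) = r₂ ≫ coprod.desc (𝟙 B) (0 : X ⟶ B) := by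
    rw [← cancel_epi ε, reassoc_of% h₁, reassoc_of% h₂]
    ext <;> simp
  have hcoeq := hk.toCoequalizer'
  obtain ⟨d, hd⟩ : ∃ d : T ⟶ B, π ≫ d = coprod.desc (𝟙 B) 0 :=
    ⟨hcoeq.desc (Cofork.ofπ _ hr), hcoeq.fac (Cofork.ofπ _ hr) .one⟩
  have hαβ : coprod.desc coprod.inl (kappa B X) ≫ π = coprod.map (𝟙 B) ξ ≫ π := by
    rw [← h₁, ← h₂, Category.assoc, Category.assoc, hk.w]
  have hξ : kappa B X ≫ π = ξ ≫ coprod.inr ≫ π := by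
    simpa using coprod.inr ≫= hαβ
  obtain ⟨u, hu⟩ := (IsKer.kernel_ι d).exists_lift (coprod.inr ≫ π) (by simp [hd])
  have hreg : IsRegularEpi (ξ ≫ u) := isRegularEpi_of_isKer (isSplitExtension_kappa B X).toIsKer
    (IsKer.kernel_ι d) (by rw [Category.assoc, hu, hξ]) hd
  have : StrongEpi u := strongEpi_of_strongEpi ξ u
  have : Mono u := by
    refine ⟨fun {Z} a b hab => ?_⟩
    have hz : (a ≫ coprod.inr) ≫ π = (b ≫ coprod.inr) ≫ π := by
      rw [Category.assoc, Category.assoc, ← hu, ← Category.assoc, hab, Category.assoc]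
    let z := hk.lift _ _ hz
    obtain ⟨y, hy⟩ := (isSplitExtension_kappa B (flat B X)).exists_lift (pullback.snd z ε) (by
      have : coprod.desc (𝟙 B) (0 : flat B X ⟶ B) = ε ≫ r₁ ≫ coprod.desc (𝟙 B) 0 := by
        rw [reassoc_of% h₁]
        ext <;> simp
      rw [this, ← pullback.condition_assoc, ← Category.assoc z, hk.lift_fst]
      simp)
    have ha : y ≫ flatMul B X = pullback.fst z ε ≫ a ≫ flatUnit B X := by
      rw [← cancel_mono (kappa B X)]
      simp only [Category.assoc, flatMul_kappa, flatUnit_kappa]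
      rw [← Category.assoc, hy, ← h₁, ← pullback.condition_assoc, hk.lift_fst]
    have hb : y ≫ flatMap (𝟙 B) ξ = pullback.fst z ε ≫ b ≫ flatUnit B X := by
      rw [← cancel_mono (kappa B X)]
      simp only [Category.assoc, flatMap_kappa, flatUnit_kappa]
      rw [← Category.assoc, hy, ← h₂, ← pullback.condition_assoc, hk.lift_snd]
    rw [← cancel_epi (pullback.fst z ε)]
    calc pullback.fst z ε ≫ a = (y ≫ flatMul B X) ≫ ξ := by rw [ha]; simp [unit]
      _ = (y ≫ flatMap (𝟙 B) ξ) ≫ ξ := by rw [Category.assoc, Category.assoc, assoc]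
      _ = pullback.fst z ε ≫ b := by rw [hb]; simp [unit]
  have : IsIso u := isIso_of_mono_of_strongEpi u
  refine ⟨T, coprod.inr ≫ π, d, coprod.inl ≫ π, ⟨⟨?_, ?_, fun t ht => ?_⟩, by simp [hd]⟩, ?_⟩
  · simp [hd]
  · rw [← hu]; infer_instance
  · obtain ⟨x, hx⟩ := (IsKer.kernel_ι d).exists_lift t ht
    exact ⟨x ≫ inv u, by rw [← hu]; simpa using hx⟩
  · rw [← hξ]
    congr 1
    ext <;> simp

end Semidirect

end PreCrossed

/-! ### Pre-crossed modules: images, kernels and the initial object -/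

namespace PreCrossed

open scoped ZeroObject

variable {C : Type u} [Category.{v} C] [HasZeroMorphisms C] [SemiAbelian C] {B : C}

lemma flatMap_id (X : C) : flatMap (𝟙 B) (𝟙 X) = 𝟙 (flat B X) := (flatFunctor B).map_id X

namespace IsSemidirect

variable {Y X S : C} {ξ : flat Y X ⟶ X} {j : X ⟶ S} {i : Y ⟶ S}

lemma w (h : IsSemidirect ξ j i) : ξ ≫ j = kappa Y X ≫ coprod.desc i j :=
  CommSq.w (IsPushout.toCommSq h)

lemma hom_ext (h : IsSemidirect ξ j i) {Z : C} {f g : S ⟶ Z} (hj : j ≫ f = j ≫ g)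
    (hi : i ≫ f = i ≫ g) : f = g :=
  IsPushout.hom_ext h hj (by ext <;> simp [hj, hi])

lemma exists_desc (h : IsSemidirect ξ j i) {Z : C} (u : X ⟶ Z) (v : Y ⟶ Z)
    (huv : ξ ≫ u = kappa Y X ≫ coprod.desc v u) :
    ∃ w : S ⟶ Z, j ≫ w = u ∧ i ≫ w = v := by
  refine ⟨IsPushout.desc h u (coprod.desc v u) huv, IsPushout.inl_desc h _ _ _, ?_⟩
  simpa using coprod.inl ≫= IsPushout.inr_desc h u (coprod.desc v u) huv

end IsSemidirect

namespace PXMod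

lemma unit (X : PXMod B) : flatUnit B X.obj ≫ X.act = 𝟙 X.obj := X.alg.unit

lemma assoc (X : PXMod B) :
    flatMap (𝟙 B) X.act ≫ X.act = flatMul B X.obj ≫ X.act := X.alg.assoc.symm

lemma flatUnit_flatMap_act (X : PXMod B) {Z : C} (g : Z ⟶ X.obj) :
    flatUnit B Z ≫ flatMap (𝟙 B) g ≫ X.act = g := by
  have : flatUnit B Z ≫ flatMap (𝟙 B) g = g ≫ flatUnit B X.obj :=
    ((flatMonad B).η.naturality g).symm
  rw [reassoc_of% this, X.unit, Category.comp_id]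

lemma flatMap_flatMap_act (X : PXMod B) {Z : C} (g : Z ⟶ X.obj) :
    flatMap (𝟙 B) (flatMap (𝟙 B) g ≫ X.act) ≫ X.act = flatMul B Z ≫ flatMap (𝟙 B) g ≫ X.act := by
  have : flatMap (𝟙 B) (flatMap (𝟙 B) g) ≫ flatMul B X.obj = flatMul B Z ≫ flatMap (𝟙 B) g :=
    (flatMonad B).μ.naturality g
  rw [← Category.comp_id (𝟙 B), ← flatMap_comp, Category.comp_id, Category.assoc, X.assoc,
    reassoc_of% this]

lemma act_δ (X : PXMod B) : X.act ≫ X.δ = kappa B X.obj ≫ coprod.desc (𝟙 B) X.δ := by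
  rw [← flatMap_conj]
  exact X.equivariant.symm

@[simp] lemma id_hom (X : PXMod B) : Hom.hom (𝟙 X) = 𝟙 X.obj := rfl

@[simp] lemma comp_hom {X Y Z : PXMod B} (f : X ⟶ Y) (g : Y ⟶ Z) :
    (f ≫ g).hom = f.hom ≫ g.hom := rfl

lemma hom_ext {X Y : PXMod B} {f g : X ⟶ Y} (h : f.hom = g.hom) : f = g := Hom.ext h

/-- A pre-crossed module from the laws of an action, with equivariance stated over `B + X`. -/
def of {X : C} (ξ : flat B X ⟶ X) (δ : X ⟶ B) (unit : flatUnit B X ≫ ξ = 𝟙 X)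
    (assoc : flatMap (𝟙 B) ξ ≫ ξ = flatMul B X ≫ ξ)
    (hδ : ξ ≫ δ = kappa B X ≫ coprod.desc (𝟙 B) δ) : PXMod B where
  alg := { A := X, a := ξ, unit := unit, assoc := assoc.symm }
  δ := δ
  equivariant := (flatMap_conj _ _).trans hδ.symm

/-- A subobject of a pre-crossed module that is stable under the action. -/
def ofMono {K : C} {W : PXMod B} (m : K ⟶ W.obj) [Mono m] (ξ : flat B K ⟶ K)
    (h : flatMap (𝟙 B) m ≫ W.act = ξ ≫ m) : PXMod B :=
  of ξ (m ≫ W.δ)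
    (by rw [← cancel_mono m, Category.assoc, ← h, W.flatUnit_flatMap_act, Category.id_comp])
    (by
      rw [← cancel_mono m, Category.assoc, Category.assoc, ← h, ← W.flatMap_flatMap_act,
        ← Category.assoc, flatMap_comp, h, Category.comp_id])
    (by
      rw [← Category.assoc, ← h, Category.assoc, W.act_δ, flatMap_kappa_assoc]
      congr 1
      ext <;> simp)

/-- The inclusion of a subobject stable under the action. -/
@[simps]
def ofMonoι {K : C} {W : PXMod B} (m : K ⟶ W.obj) [Mono m] (ξ : flat B K ⟶ K)
    (h : flatMap (𝟙 B) m ≫ W.act = ξ ≫ m) : ofMono m ξ h ⟶ W where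
  hom := m
  act_hom := h
  hom_δ := rfl

/-- An arrow is a morphism if its composite with a monomorphism is. -/
lemma exists_hom_of_comp_mono {X Y Z : PXMod B} (m : Y ⟶ Z) [Mono m.hom] (h : X ⟶ Z)
    (u : X.obj ⟶ Y.obj) (hu : u ≫ m.hom = h.hom) : ∃ v : X ⟶ Y, v.hom = u ∧ v ≫ m = h := by
  refine ⟨⟨u, ?_, ?_⟩, rfl, hom_ext hu⟩
  · rw [← cancel_mono m.hom, Category.assoc, ← m.act_hom, ← Category.assoc, flatMap_comp, hu,
      Category.comp_id, h.act_hom, Category.assoc, hu]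
  · rw [← m.hom_δ, ← Category.assoc, hu, h.hom_δ]

lemma mono_of_mono_hom {X Y : PXMod B} (f : X ⟶ Y) [Mono f.hom] : Mono f :=
  ⟨fun _ _ e => hom_ext ((cancel_mono f.hom).1 (congrArg Hom.hom e))⟩

lemma isIso_of_isIso_hom {X Y : PXMod B} (f : X ⟶ Y) [IsIso f.hom] : IsIso f := by
  refine ⟨⟨⟨inv f.hom, ?_, by rw [IsIso.inv_comp_eq, f.hom_δ]⟩, hom_ext (IsIso.hom_inv_id f.hom),
    hom_ext (IsIso.inv_hom_id f.hom)⟩⟩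
  rw [← cancel_mono f.hom, Category.assoc, ← f.act_hom, ← Category.assoc, flatMap_comp]
  simp [flatMap_id]

/-- The kernel pair of a morphism of pre-crossed modules. -/
def kernelPair {X Y : PXMod B} (f : X ⟶ Y) : PXMod B :=
  have h : (flatMap (𝟙 B) (pullback.fst f.hom f.hom) ≫ X.act) ≫ f.hom =
      (flatMap (𝟙 B) (pullback.snd f.hom f.hom) ≫ X.act) ≫ f.hom := by
    rw [Category.assoc, ← f.act_hom, ← Category.assoc, flatMap_comp, pullback.condition,
      ← flatMap_comp, Category.assoc, f.act_hom, Category.assoc]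
  of (pullback.lift _ _ h) (pullback.fst f.hom f.hom ≫ X.δ)
    (by ext <;> simp [flatUnit_flatMap_act])
    (by
      ext
      · simp only [Category.assoc, pullback.lift_fst]
        rw [← Category.assoc, flatMap_comp, pullback.lift_fst, Category.comp_id,
          flatMap_flatMap_act]
      · simp only [Category.assoc, pullback.lift_snd]
        rw [← Category.assoc, flatMap_comp, pullback.lift_snd, Category.comp_id,
          flatMap_flatMap_act])
    (by
      rw [pullback.lift_fst_assoc, Category.assoc, X.act_δ, flatMap_kappa_assoc]
      congr 1
      ext <;> simp)

/-- The first projection of the kernel pair. -/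
@[simps]
def kernelPairFst {X Y : PXMod B} (f : X ⟶ Y) : kernelPair f ⟶ X where
  hom := pullback.fst f.hom f.hom
  act_hom := (pullback.lift_fst _ _ _).symm
  hom_δ := rfl

/-- The second projection of the kernel pair. -/
@[simps]
def kernelPairSnd {X Y : PXMod B} (f : X ⟶ Y) : kernelPair f ⟶ X where
  hom := pullback.snd f.hom f.hom
  act_hom := (pullback.lift_snd _ _ _).symm
  hom_δ := by
    change _ = pullback.fst f.hom f.hom ≫ X.δ
    rw [← f.hom_δ, pullback.condition_assoc]
    rfl

lemma kernelPair_condition {X Y : PXMod B} (f : X ⟶ Y) :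
    kernelPairFst f ≫ f = kernelPairSnd f ≫ f := hom_ext pullback.condition

instance mono_hom {X Y : PXMod B} (f : X ⟶ Y) [Mono f] : Mono f.hom :=
  (IsKernelPair.of_hasPullback f.hom).mono_of_eq_fst_snd
    (congrArg Hom.hom ((cancel_mono f).1 (kernelPair_condition f)))

/-- A regular epimorphism in the base category is a coequalizer of its kernel pair in pre-crossed
modules, because `B ♭ (-)` preserves epimorphisms of this kind. -/
lemma isRegularEpi_of_hom {X Y : PXMod B} (f : X ⟶ Y) [IsRegularEpi f.hom] : IsRegularEpi f := by
  have hc := (IsKernelPair.of_hasPullback f.hom).toCoequalizer'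
  have hdesc : ∀ {Z : PXMod B} (g : X ⟶ Z), kernelPairFst f ≫ g = kernelPairSnd f ≫ g →
      ∃ h : Y ⟶ Z, f ≫ h = g := fun {Z} g hg => by
    obtain ⟨h, hh⟩ : ∃ h : Y.obj ⟶ Z.obj, f.hom ≫ h = g.hom :=
      ⟨hc.desc (Cofork.ofπ g.hom (congrArg Hom.hom hg)),
        hc.fac (Cofork.ofπ g.hom (congrArg Hom.hom hg)) .one⟩
    refine ⟨⟨h, ?_, ?_⟩, hom_ext hh⟩
    · rw [← cancel_epi (flatMap (𝟙 B) f.hom), ← Category.assoc, flatMap_comp, hh, ← Category.assoc,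
        f.act_hom, Category.assoc, hh, Category.comp_id, g.act_hom]
    · rw [← cancel_epi f.hom, ← Category.assoc, hh, g.hom_δ, f.hom_δ]
  exact ⟨⟨{
    W := kernelPair f
    left := kernelPairFst f
    right := kernelPairSnd f
    w := kernelPair_condition f
    isColimit := Cofork.IsColimit.mk _ (fun s => (hdesc s.π s.condition).choose)
      (fun s => (hdesc s.π s.condition).choose_spec)
      (fun s m hm => hom_ext ((cancel_epi f.hom).1 (congrArg Hom.hom
        (hm.trans (hdesc s.π s.condition).choose_spec.symm)))) }⟩⟩

/-- Images of pre-crossed modules are computed in the base category. -/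
lemma exists_image {X Y : PXMod B} (f : X ⟶ Y) :
    ∃ (I : PXMod B) (e : X ⟶ I) (m : I ⟶ Y), IsRegularEpi e.hom ∧ Mono m ∧ e ≫ m = f := by
  obtain ⟨I, e, m, he, hm, fac⟩ := exists_regularEpi_mono f.hom
  have sq : CommSq (X.act ≫ e) (flatMap (𝟙 B) e) m (flatMap (𝟙 B) m ≫ Y.act) :=
    ⟨by rw [Category.assoc, fac, ← Category.assoc, flatMap_comp, fac, Category.comp_id, f.act_hom]⟩
  have : Mono (ofMonoι m sq.lift sq.fac_right.symm).hom := hm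
  exact ⟨ofMono m sq.lift sq.fac_right.symm,
    ⟨e, sq.fac_left, (Category.assoc _ _ _).symm.trans ((fac =≫ Y.δ).trans f.hom_δ)⟩,
    ofMonoι m sq.lift sq.fac_right.symm, he, mono_of_mono_hom _, hom_ext fac⟩

/-- A strong epimorphism of pre-crossed modules is a regular epimorphism in the base category,
hence also in pre-crossed modules. -/
instance isRegularEpi_hom {X Y : PXMod B} (f : X ⟶ Y) [StrongEpi f] : IsRegularEpi f.hom := by
  obtain ⟨I, e, m, he, hm, rfl⟩ := exists_image f
  have := strongEpi_of_strongEpi e m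
  have := isIso_of_mono_of_strongEpi m
  have : IsIso m.hom := ⟨(inv m).hom, congrArg Hom.hom (IsIso.hom_inv_id m),
    congrArg Hom.hom (IsIso.inv_hom_id m)⟩
  have : StrongEpi (e ≫ m).hom := by rw [comp_hom]; infer_instance
  infer_instance

/-- The kernel of a morphism, computed in the base category, is stable under the action. -/
lemma exists_kernel {W S : PXMod B} (f : W ⟶ S) :
    ∃ (K : PXMod B) (k : K ⟶ W), IsKer k.hom f.hom := by
  have h : (flatMap (𝟙 B) (kernel.ι f.hom) ≫ W.act) ≫ f.hom = 0 := by
    rw [Category.assoc, ← f.act_hom, ← Category.assoc, flatMap_comp, kernel.condition, flatMap_zero,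
      zero_comp]
  exact ⟨_, ofMonoι (kernel.ι f.hom) (kernel.lift f.hom _ h) (kernel.lift_ι _ _ _).symm,
    IsKer.kernel_ι _⟩

/-- The zero object with its action, which is the initial pre-crossed module. -/
def zero (B : C) : PXMod B :=
  of (X := (0 : C)) 0 0 ((isZero_zero C).eq_of_src _ _) ((isZero_zero C).eq_of_tgt _ _)
    (by
      have : coprod.desc (𝟙 B) (0 : (0 : C) ⟶ B) = coprod.desc (𝟙 B) 0 ≫ 𝟙 B := by simp
      rw [this, kappa_desc_assoc, zero_comp, zero_comp])

lemma isZero_zero_obj (B : C) : IsZero (zero B).obj := isZero_zero C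

/-- The arrow of underlying objects `0 : Z ⟶ X` is a morphism if `δ` vanishes on `Z`. -/
def zeroHom {Z X : PXMod B} (h : Z.δ = 0) : Z ⟶ X where
  hom := 0
  act_hom := by rw [flatMap_zero, zero_comp, comp_zero]
  hom_δ := by rw [h, zero_comp]

/-- The zero object is initial among pre-crossed modules. -/
def isInitialZero (B : C) : IsInitial (zero B) :=
  IsInitial.ofUniqueHom (fun _ => zeroHom rfl)
    (fun _ _ => hom_ext ((isZero_zero_obj B).eq_of_src _ _))

instance : HasInitial (PXMod B) := (isInitialZero B).hasInitial

/-- The object `B` with the conjugation action, which is the terminal pre-crossed module. -/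
def self (B : C) : PXMod B :=
  of (conj B) (𝟙 B) (by simp [conj])
    (by
      rw [flatMap_conj, conj, flatMul_kappa_assoc]
      congr 1
      ext <;> simp)
    (by rw [Category.comp_id, conj])

/-- The arrow `δ` as a morphism of pre-crossed modules. -/
def toSelf (X : PXMod B) : X ⟶ self B where
  hom := X.δ
  act_hom := X.equivariant
  hom_δ := Category.comp_id _

lemma isZero_of_isInitial {Z : PXMod B} (hZ : IsInitial Z) : IsZero Z.obj := by
  have e := hZ.uniqueUpToIso (isInitialZero B)
  exact (isZero_zero_obj B).of_iso
    ⟨e.hom.hom, e.inv.hom, congrArg Hom.hom e.hom_inv_id, congrArg Hom.hom e.inv_hom_id⟩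

/-- A pre-crossed module `X` is the kernel of a reflexive graph `d, c : T ⟶ B` with section `i`. -/
lemma exists_reflexiveGraph (X : PXMod B) :
    ∃ (T : C) (j : X.obj ⟶ T) (d c : T ⟶ B) (i : B ⟶ T), IsSplitExtension j d i ∧
      X.act ≫ j = kappa B X.obj ≫ coprod.desc i j ∧ i ≫ c = 𝟙 B ∧ j ≫ c = X.δ := by
  obtain ⟨T, j, d, i, h, hX⟩ := exists_isSplitExtension X.act X.unit X.assoc
  obtain ⟨c, hc₁, hc₂⟩ := (h.isSemidirect hX).exists_desc X.δ (𝟙 B) X.act_δ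
  exact ⟨T, j, d, c, i, h, hX, hc₂, hc₁⟩

end PXMod

end PreCrossed

/-! ### Reflexive graphs and colimits of pre-crossed modules -/

namespace PreCrossed

section Graphs

variable {C : Type u} [Category.{v} C] {B : C}

/-- A reflexive graph in `C` with object of vertices `B`: object of edges `T`, domain `d`,
codomain `c` and degeneracy `i`. -/
structure ReflexiveGraph (B : C) where
  T : C
  d : T ⟶ B
  c : T ⟶ B
  i : B ⟶ T
  i_d : i ≫ d = 𝟙 B
  i_c : i ≫ c = 𝟙 B

namespace ReflexiveGraph

/-- A morphism of reflexive graphs that is the identity on vertices. -/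
@[ext]
structure Hom (G H : ReflexiveGraph B) where
  hom : G.T ⟶ H.T
  hom_d : hom ≫ H.d = G.d
  hom_c : hom ≫ H.c = G.c
  i_hom : G.i ≫ hom = H.i

instance : Category (ReflexiveGraph B) where
  Hom := Hom
  id G := ⟨𝟙 G.T, by simp, by simp, by simp⟩
  comp f g := ⟨f.hom ≫ g.hom, by rw [Category.assoc, g.hom_d, f.hom_d],
    by rw [Category.assoc, g.hom_c, f.hom_c], by rw [← Category.assoc, f.i_hom, g.i_hom]⟩
  id_comp f := Hom.ext (Category.id_comp _)
  comp_id f := Hom.ext (Category.comp_id _)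
  assoc f g h := Hom.ext (Category.assoc _ _ _)

lemma hom_ext {G H : ReflexiveGraph B} {f g : G ⟶ H} (h : f.hom = g.hom) : f = g := Hom.ext h

end ReflexiveGraph

end Graphs

variable {C : Type u} [Category.{v} C] [HasZeroMorphisms C] [SemiAbelian C] {B : C}

namespace ReflexiveGraph

/-- Pushouts of reflexive graphs over `B` are pushouts of the objects of edges. -/
instance : HasPushouts (ReflexiveGraph B) := by
  refine @hasPushouts_of_hasColimit_span _ _ (fun {X Y Z f g} => ?_)
  let P : ReflexiveGraph B :=
    { T := pushout f.hom g.hom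
      d := pushout.desc Y.d Z.d (by rw [f.hom_d, g.hom_d])
      c := pushout.desc Y.c Z.c (by rw [f.hom_c, g.hom_c])
      i := X.i ≫ f.hom ≫ pushout.inl _ _
      i_d := by rw [Category.assoc, Category.assoc, pushout.inl_desc, f.hom_d, X.i_d]
      i_c := by rw [Category.assoc, Category.assoc, pushout.inl_desc, f.hom_c, X.i_c] }
  let l : Y ⟶ P := ⟨pushout.inl _ _, pushout.inl_desc _ _ _, pushout.inl_desc _ _ _, by
    rw [← f.i_hom, Category.assoc]⟩
  let r : Z ⟶ P := ⟨pushout.inr _ _, pushout.inr_desc _ _ _, pushout.inr_desc _ _ _, by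
    rw [← g.i_hom, Category.assoc, ← pushout.condition]⟩
  have hlr : f ≫ l = g ≫ r := hom_ext pushout.condition
  refine ⟨⟨⟨PushoutCocone.mk l r hlr, PushoutCocone.IsColimit.mk hlr
    (fun s => ⟨pushout.desc s.inl.hom s.inr.hom (congrArg Hom.hom s.condition), ?_, ?_, ?_⟩)
    (fun s => hom_ext (pushout.inl_desc _ _ _)) (fun s => hom_ext (pushout.inr_desc _ _ _))
    (fun s m h₁ h₂ => hom_ext (pushout.hom_ext ?_ ?_))⟩⟩⟩
  · apply pushout.hom_ext
    · rw [pushout.inl_desc_assoc, s.inl.hom_d, pushout.inl_desc]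
    · rw [pushout.inr_desc_assoc, s.inr.hom_d, pushout.inr_desc]
  · apply pushout.hom_ext
    · rw [pushout.inl_desc_assoc, s.inl.hom_c, pushout.inl_desc]
    · rw [pushout.inr_desc_assoc, s.inr.hom_c, pushout.inr_desc]
  · change (X.i ≫ f.hom ≫ pushout.inl _ _) ≫ _ = _
    rw [Category.assoc, Category.assoc, pushout.inl_desc, ← Category.assoc, f.i_hom, s.inl.i_hom]
  · exact (congrArg Hom.hom h₁).trans (pushout.inl_desc _ _ _).symm
  · exact (congrArg Hom.hom h₂).trans (pushout.inr_desc _ _ _).symm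

lemma isSplitExtension (G : ReflexiveGraph B) : IsSplitExtension (kernel.ι G.d) G.d G.i where
  toIsKer := .kernel_ι _
  section_comp := G.i_d

/-- The conjugation action of the vertices of a reflexive graph on the kernel of `d`. -/
def action (G : ReflexiveGraph B) : flat B (kernel G.d) ⟶ kernel G.d :=
  kernel.lift G.d (kappa B (kernel G.d) ≫ coprod.desc G.i (kernel.ι G.d)) (by
    have : coprod.desc G.i (kernel.ι G.d) ≫ G.d = coprod.desc (𝟙 B) 0 := by
      ext <;> simp [G.i_d]
    rw [Category.assoc, this, kappa_desc])

@[simp]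
lemma action_ι (G : ReflexiveGraph B) : G.action ≫ kernel.ι G.d =
    kappa B (kernel G.d) ≫ coprod.desc G.i (kernel.ι G.d) := kernel.lift_ι _ _ _

@[simp]
lemma action_ι_assoc (G : ReflexiveGraph B) {Z : C} (h : G.T ⟶ Z) : G.action ≫ kernel.ι G.d ≫ h =
    kappa B (kernel G.d) ≫ coprod.desc G.i (kernel.ι G.d) ≫ h := by
  rw [← Category.assoc, action_ι, Category.assoc]

/-- The pre-crossed module of a reflexive graph: the kernel of `d` with the conjugation action and
the restriction of `c`. -/
def toPXMod (G : ReflexiveGraph B) : PXMod B :=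
  .of G.action (kernel.ι G.d ≫ G.c)
    (by simp [← cancel_mono (kernel.ι G.d)])
    (by
      simp only [← cancel_mono (kernel.ι G.d), Category.assoc, action_ι, flatMap_kappa_assoc,
        flatMul_kappa_assoc]
      congr 1
      ext <;> simp)
    (by
      rw [action_ι_assoc]
      congr 1
      ext <;> simp [G.i_c])

/-- The restriction of a morphism of reflexive graphs to the kernels of `d`. -/
def kernelMap {G H : ReflexiveGraph B} (f : G ⟶ H) : kernel G.d ⟶ kernel H.d :=
  kernel.lift H.d (kernel.ι G.d ≫ f.hom) (by rw [Category.assoc, f.hom_d, kernel.condition])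

@[simp]
lemma kernelMap_ι {G H : ReflexiveGraph B} (f : G ⟶ H) :
    kernelMap f ≫ kernel.ι H.d = kernel.ι G.d ≫ f.hom := kernel.lift_ι _ _ _

lemma flatMap_kernelMap {G H : ReflexiveGraph B} (f : G ⟶ H) :
    flatMap (𝟙 B) (kernelMap f) ≫ H.action = G.action ≫ kernelMap f := by
  simp only [← cancel_mono (kernel.ι H.d), Category.assoc, action_ι, flatMap_kappa_assoc,
    kernelMap_ι, action_ι_assoc]
  congr 1
  ext <;> simp [f.i_hom]

lemma kernelMap_ι_c {G H : ReflexiveGraph B} (f : G ⟶ H) :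
    kernelMap f ≫ kernel.ι H.d ≫ H.c = kernel.ι G.d ≫ G.c := by
  rw [← Category.assoc, kernelMap_ι, Category.assoc, f.hom_c]

lemma kernelMap_id (G : ReflexiveGraph B) : kernelMap (𝟙 G) = 𝟙 (kernel G.d) := by
  rw [← cancel_mono (kernel.ι G.d), kernelMap_ι, Category.id_comp]
  exact Category.comp_id _

lemma kernelMap_comp {G H K : ReflexiveGraph B} (f : G ⟶ H) (g : H ⟶ K) :
    kernelMap (f ≫ g) = kernelMap f ≫ kernelMap g := by
  rw [← cancel_mono (kernel.ι K.d), Category.assoc, kernelMap_ι, kernelMap_ι, ← Category.assoc,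
    kernelMap_ι, Category.assoc]
  rfl

/-- Taking the kernel of `d` is a functor from reflexive graphs over `B` to pre-crossed modules
over `B`. -/
def kernelFunctor (B : C) : ReflexiveGraph B ⥤ PXMod B where
  obj := toPXMod
  map f :=
    { hom := kernelMap f
      act_hom := flatMap_kernelMap f
      hom_δ := kernelMap_ι_c f }
  map_id G := PXMod.hom_ext (kernelMap_id G)
  map_comp f g := PXMod.hom_ext (kernelMap_comp f g)

/-- A morphism out of a split extension is determined by its values on the kernel and the section. -/
instance : (kernelFunctor B).Faithful where
  map_injective {G H f g} h := by
    have h' : kernelMap f = kernelMap g := congrArg PXMod.Hom.hom h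
    exact hom_ext (G.isSplitExtension.hom_ext (by rw [← kernelMap_ι, h', kernelMap_ι])
      (by rw [f.i_hom, g.i_hom]))

/-- A morphism of pre-crossed modules extends to the semidirect products with `B`. -/
instance : (kernelFunctor B).Full where
  map_surjective {G H} f := by
    have hG := G.isSplitExtension.isSemidirect G.action_ι
    let f' : kernel G.d ⟶ kernel H.d := f.hom
    have hf : flatMap (𝟙 B) f' ≫ H.action = G.action ≫ f' := f.act_hom
    have hδ : f' ≫ kernel.ι H.d ≫ H.c = kernel.ι G.d ≫ G.c := f.hom_δ
    obtain ⟨w, hw₁, hw₂⟩ := hG.exists_desc (f' ≫ kernel.ι H.d) H.i (by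
      rw [← Category.assoc, ← hf, Category.assoc, action_ι, flatMap_kappa_assoc]
      congr 1
      ext <;> simp)
    refine ⟨⟨w, hG.hom_ext ?_ ?_, hG.hom_ext ?_ ?_, hw₂⟩, PXMod.hom_ext ?_⟩
    · rw [← Category.assoc, hw₁, Category.assoc, kernel.condition, kernel.condition, comp_zero]
    · rw [← Category.assoc, hw₂, H.i_d, G.i_d]
    · rw [← Category.assoc, hw₁, Category.assoc, hδ]
    · rw [← Category.assoc, hw₂, H.i_c, G.i_c]
    · change kernelMap _ = f'
      rw [← cancel_mono (kernel.ι H.d), kernelMap_ι, hw₁]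

/-- The semidirect product with `B` is a reflexive graph with the given kernel. -/
instance : (kernelFunctor B).EssSurj where
  mem_essImage X := by
    obtain ⟨T, j, d, c, i, h, hX, hi, hj⟩ := X.exists_reflexiveGraph
    let G : ReflexiveGraph B := ⟨T, d, c, i, h.section_comp, hi⟩
    have := h.mono
    obtain ⟨u, hu⟩ := h.exists_lift (kernel.ι d) (kernel.condition d)
    have hv : kernel.lift d j h.zero ≫ u = 𝟙 _ := by
      rw [← cancel_mono j, Category.assoc, hu, kernel.lift_ι, Category.id_comp]
    have hv' : u ≫ kernel.lift d j h.zero = 𝟙 _ := by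
      rw [← cancel_mono (kernel.ι d), Category.assoc, kernel.lift_ι, hu, Category.id_comp]
    have hact : flatMap (𝟙 B) u ≫ X.act = G.action ≫ u := by
      rw [← cancel_mono j, Category.assoc, Category.assoc, hX, hu, flatMap_kappa_assoc]
      refine Eq.trans ?_ G.action_ι.symm
      congr 1
      ext <;> simp [hu, G]
    have hδ : u ≫ X.δ = kernel.ι d ≫ c := by rw [← hj, ← Category.assoc, hu]
    let f : (kernelFunctor B).obj G ⟶ X := { hom := u, act_hom := hact, hom_δ := hδ }
    have : IsIso f.hom := ⟨_, hv', hv⟩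
    have := PXMod.isIso_of_isIso_hom f
    exact ⟨G, ⟨asIso f⟩⟩

/-- Pre-crossed modules are equivalent to reflexive graphs. -/
instance : (kernelFunctor B).IsEquivalence where

end ReflexiveGraph

instance : HasPushouts (PXMod B) :=
  Adjunction.hasColimitsOfShape_of_equivalence (ReflexiveGraph.kernelFunctor B).inv

instance : HasBinaryCoproducts (PXMod B) := hasBinaryCoproducts_of_hasInitial_and_pushouts _

end PreCrossed

/-! ### Semidirect products of pre-crossed modules -/

namespace PreCrossed

variable {C : Type u} [Category.{v} C] [HasZeroMorphisms C] [SemiAbelian C] {B : C}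

/-- A pre-crossed module structure on the pullback of `T ⟶ B` along `δ_Y`, where `T` is the
semidirect product of `X` and `B`. -/
theorem exists_semidirectProduct (X Y : PXMod B) : ∃ S : SemidirectProduct X Y,
    IsSplitExtension S.j.hom S.p S.i.hom ∧ JointlyMono₂ S.p S.t := by
  obtain ⟨T, j, d, c, i, h, hX, hic, hjc⟩ := X.exists_reflexiveGraph
  have := h.mono
  let p : pullback Y.δ d ⟶ Y.obj := pullback.fst _ _
  let t : pullback Y.δ d ⟶ T := pullback.snd _ _
  have hpt : p ≫ Y.δ = t ≫ d := pullback.condition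
  let a : flat B (pullback Y.δ d) ⟶ pullback Y.δ d :=
    pullback.lift (flatMap (𝟙 B) p ≫ Y.act) (flatMap i t ≫ conj T) (by
      rw [flatMap_conj, Category.assoc, Y.act_δ, flatMap_kappa_assoc, Category.assoc]
      congr 1
      ext <;> simp [h.section_comp, hpt])
  have hap : a ≫ p = flatMap (𝟙 B) p ≫ Y.act := pullback.lift_fst _ _ _
  have hat : a ≫ t = flatMap i t ≫ conj T := pullback.lift_snd _ _ _
  let S : PXMod B := .of a (t ≫ c)
    (by
      apply pullback.hom_ext
      · change (_ ≫ a) ≫ p = _ ≫ p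
        rw [Category.assoc, hap, Y.flatUnit_flatMap_act, Category.id_comp]
      · change (_ ≫ a) ≫ t = _ ≫ t
        rw [Category.assoc, hat, flatMap_conj]
        simp)
    (by
      apply pullback.hom_ext
      · change (_ ≫ a) ≫ p = (_ ≫ a) ≫ p
        rw [Category.assoc, Category.assoc, hap, ← Y.flatMap_flatMap_act, ← Category.assoc,
          flatMap_comp, hap, Category.comp_id]
      · change (_ ≫ a) ≫ t = (_ ≫ a) ≫ t
        rw [Category.assoc, Category.assoc, hat, ← Category.assoc, flatMap_comp, hat, flatMap_conj,
          flatMap_conj, flatMul_kappa_assoc]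
        congr 1
        ext <;> simp)
    (by
      rw [← Category.assoc, hat, flatMap_conj, Category.assoc]
      congr 1
      ext <;> simp [hic])
  let jS : X.obj ⟶ pullback Y.δ d := pullback.lift 0 j (by rw [zero_comp, h.zero])
  let iS : Y.obj ⟶ pullback Y.δ d := pullback.lift (𝟙 _) (Y.δ ≫ i) (by simp [h.section_comp])
  have hjp : jS ≫ p = 0 := pullback.lift_fst _ _ _
  have hjt : jS ≫ t = j := pullback.lift_snd _ _ _
  have hip : iS ≫ p = 𝟙 _ := pullback.lift_fst _ _ _
  have hit : iS ≫ t = Y.δ ≫ i := pullback.lift_snd _ _ _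
  have hS : IsSplitExtension jS p iS :=
    { zero := hjp
      mono := by
        have : Mono (jS ≫ t) := hjt ▸ h.mono
        exact mono_of_mono jS t
      exists_lift := fun u hu => by
        obtain ⟨x, hx⟩ := h.exists_lift (u ≫ t) (by
          rw [Category.assoc, ← hpt, ← Category.assoc, hu, zero_comp])
        refine ⟨x, pullback.hom_ext ?_ ?_⟩
        · change (x ≫ jS) ≫ p = u ≫ p
          rw [Category.assoc, hjp, hu, comp_zero]
        · change (x ≫ jS) ≫ t = u ≫ t
          rw [Category.assoc, hjt, hx]
      section_comp := hip }
  have hjact : flatMap (𝟙 B) jS ≫ a = X.act ≫ jS := by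
    apply pullback.hom_ext
    · change (_ ≫ a) ≫ p = (_ ≫ jS) ≫ p
      rw [Category.assoc, hap, ← Category.assoc, flatMap_comp, hjp, flatMap_zero, Category.assoc,
        hjp, zero_comp, comp_zero]
    · change (_ ≫ a) ≫ t = (_ ≫ jS) ≫ t
      rw [Category.assoc, hat, ← Category.assoc, flatMap_comp, Category.id_comp, hjt, flatMap_conj,
        Category.assoc, hjt, hX]
  have hiact : flatMap (𝟙 B) iS ≫ a = Y.act ≫ iS := by
    apply pullback.hom_ext
    · change (_ ≫ a) ≫ p = (_ ≫ iS) ≫ p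
      rw [Category.assoc, hap, ← Category.assoc, flatMap_comp, hip, Category.comp_id, flatMap_id,
        Category.id_comp, Category.assoc, hip, Category.comp_id]
    · change (_ ≫ a) ≫ t = (_ ≫ iS) ≫ t
      rw [Category.assoc, hat, ← Category.assoc, flatMap_comp, Category.id_comp, hit, flatMap_conj,
        Category.assoc, hit, ← Category.assoc, Y.act_δ, Category.assoc]
      congr 1
      ext <;> simp
  have hYX : (flatMap Y.δ (𝟙 X.obj) ≫ X.act) ≫ jS = kappa Y.obj X.obj ≫ coprod.desc iS jS := by
    apply pullback.hom_ext
    · change (_ ≫ jS) ≫ p = (_ ≫ coprod.desc iS jS) ≫ p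
      have : coprod.desc iS jS ≫ p = coprod.desc (𝟙 _) 0 := by ext <;> simp [hip, hjp]
      rw [Category.assoc, hjp, comp_zero, Category.assoc, this, kappa_desc]
    · change (_ ≫ jS) ≫ t = (_ ≫ coprod.desc iS jS) ≫ t
      rw [Category.assoc, hjt, Category.assoc, hX, flatMap_kappa_assoc, Category.assoc]
      congr 1
      ext <;> simp [hit, hjt]
  exact ⟨{
    T := T
    jT := j
    iT := i
    isSemidirect_T := h.isSemidirect hX
    S := S
    j := ⟨jS, hjact, (Category.assoc _ _ _).symm.trans ((hjt =≫ c).trans hjc)⟩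
    i := ⟨iS, hiact, (Category.assoc _ _ _).symm.trans ((hit =≫ c).trans (by
      rw [Category.assoc, hic, Category.comp_id]))⟩
    isSemidirect_S := hS.isSemidirect hYX
    p := p
    j_p := hjp
    i_p := hip
    t := t
    j_t := hjt
    i_t := hit
    act_p := hap
    act_t := hat }, hS, ⟨fun _ _ _ => pullback.hom_ext⟩⟩

namespace SemidirectProduct

section Functoriality

variable {X Y X' Y' : PXMod B} (S : SemidirectProduct X Y) (S' : SemidirectProduct X' Y')
  (f : X ⟶ X') (g : Y ⟶ Y')

/-- The arrow `f ⋊ g` in the base category, together with the arrow `τ = f ⋊ 1` between the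
semidirect products with `B`. -/
lemma exists_arrow : ∃ (σ : S.S.obj ⟶ S'.S.obj) (τ : S.T ⟶ S'.T),
    S.j.hom ≫ σ = f.hom ≫ S'.j.hom ∧ S.i.hom ≫ σ = g.hom ≫ S'.i.hom ∧
      σ ≫ S'.p = S.p ≫ g.hom ∧ S.iT ≫ τ = S'.iT ∧ σ ≫ S'.t = S.t ≫ τ := by
  obtain ⟨σ, hσj, hσi⟩ := S.isSemidirect_S.exists_desc (f.hom ≫ S'.j.hom) (g.hom ≫ S'.i.hom) (by
    calc (flatMap Y.δ (𝟙 X.obj) ≫ X.act) ≫ f.hom ≫ S'.j.hom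
        = (flatMap Y.δ (𝟙 X.obj) ≫ flatMap (𝟙 B) f.hom) ≫ X'.act ≫ S'.j.hom := by
          rw [Category.assoc, Category.assoc, ← Category.assoc X.act, ← f.act_hom, Category.assoc]
      _ = flatMap g.hom f.hom ≫ (flatMap Y'.δ (𝟙 X'.obj) ≫ X'.act) ≫ S'.j.hom := by
          rw [flatMap_comp, Category.assoc (flatMap Y'.δ _), ← Category.assoc (flatMap g.hom _),
            flatMap_comp, g.hom_δ]
          simp
      _ = _ := by
          rw [S'.isSemidirect_S.w, flatMap_kappa_assoc]
          congr 1
          ext <;> simp)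
  obtain ⟨τ, hτj, hτi⟩ := S.isSemidirect_T.exists_desc (f.hom ≫ S'.jT) S'.iT (by
    rw [← Category.assoc, ← f.act_hom, Category.assoc, S'.isSemidirect_T.w, flatMap_kappa_assoc]
    congr 1
    ext <;> simp)
  refine ⟨σ, τ, hσj, hσi, S.isSemidirect_S.hom_ext ?_ ?_, hτi, S.isSemidirect_S.hom_ext ?_ ?_⟩
  · rw [← Category.assoc, hσj, Category.assoc, S'.j_p, ← Category.assoc, S.j_p, comp_zero,
      zero_comp]
  · rw [← Category.assoc, hσi, Category.assoc, S'.i_p, ← Category.assoc, S.i_p, Category.comp_id,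
      Category.id_comp]
  · rw [← Category.assoc, hσj, Category.assoc, S'.j_t, ← Category.assoc, S.j_t, hτj]
  · rw [← Category.assoc, hσi, Category.assoc, S'.i_t, ← Category.assoc, g.hom_δ,
      ← Category.assoc, S.i_t, Category.assoc, hτi]

end Functoriality

variable {X Y : PXMod B}

/-- Since `S.S` is a pushout, every semidirect product shares the properties of the one constructed
as a pullback. -/
lemma isSplitExtension_and_jointlyMono (S : SemidirectProduct X Y) :
    IsSplitExtension S.j.hom S.p S.i.hom ∧ JointlyMono₂ S.p S.t := by
  obtain ⟨S₀, h₀, hm⟩ := exists_semidirectProduct X Y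
  obtain ⟨σ, τ, hj, hi, hp, -, ht⟩ := S.exists_arrow S₀ (𝟙 X) (𝟙 Y)
  obtain ⟨σ', -, hj', hi', -, -, -⟩ := S₀.exists_arrow S (𝟙 X) (𝟙 Y)
  simp only [PXMod.id_hom, Category.id_comp, Category.comp_id] at hj hi hp hj' hi'
  have hσ : σ ≫ σ' = 𝟙 _ := S.isSemidirect_S.hom_ext
    (by rw [← Category.assoc, hj, hj', Category.comp_id])
    (by rw [← Category.assoc, hi, hi', Category.comp_id])
  have : Mono σ := mono_of_mono_fac hσ
  have := h₀.mono
  refine ⟨⟨⟨S.j_p, mono_of_mono_fac hj, fun u hu => ?_⟩, S.i_p⟩, ⟨fun Z a b hab hab' => ?_⟩⟩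
  · obtain ⟨x, hx⟩ := h₀.exists_lift (u ≫ σ) (by rw [Category.assoc, hp, hu])
    exact ⟨x, by rw [← hj', ← Category.assoc, hx, Category.assoc, hσ, Category.comp_id]⟩
  · rw [← cancel_mono σ]
    apply hm.right_cancellation
    · rw [Category.assoc, hp, hab, Category.assoc, hp]
    · rw [Category.assoc, ht, ← Category.assoc, hab', Category.assoc, Category.assoc, ht]

lemma isSplitExtension (S : SemidirectProduct X Y) : IsSplitExtension S.j.hom S.p S.i.hom :=
  S.isSplitExtension_and_jointlyMono.1

/-- The arrow `f ⋊ g` is a morphism of pre-crossed modules: equivariance is checked after the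
jointly monic arrows `p` and `t`, which determine the action. -/
theorem exists_map {X' Y' : PXMod B} (S : SemidirectProduct X Y) (S' : SemidirectProduct X' Y')
    (f : X ⟶ X') (g : Y ⟶ Y') : ∃ σ : S.S ⟶ S'.S,
      S.j ≫ σ = f ≫ S'.j ∧ S.i ≫ σ = g ≫ S'.i ∧ σ.hom ≫ S'.p = S.p ≫ g.hom := by
  obtain ⟨σ, τ, hj, hi, hp, hτ, ht⟩ := S.exists_arrow S' f g
  refine ⟨⟨σ, S'.isSplitExtension_and_jointlyMono.2.right_cancellation _ _ ?_ ?_,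
    S.isSemidirect_S.hom_ext ?_ ?_⟩, PXMod.hom_ext hj, PXMod.hom_ext hi, hp⟩
  · rw [Category.assoc, S'.act_p, ← Category.assoc, flatMap_comp, hp, ← flatMap_comp,
      Category.assoc, g.act_hom, ← Category.assoc, ← S.act_p, Category.assoc, Category.assoc, hp]
  · rw [Category.assoc, S'.act_t, ← Category.assoc, flatMap_comp, flatMap_conj, Category.assoc, ht,
      ← Category.assoc, S.act_t, flatMap_conj, Category.assoc]
    congr 1
    ext <;> simp [hτ]
  · rw [← Category.assoc, hj, Category.assoc, S'.j.hom_δ, f.hom_δ, S.j.hom_δ]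
  · rw [← Category.assoc, hi, Category.assoc, S'.i.hom_δ, g.hom_δ, S.i.hom_δ]

end SemidirectProduct

/-- Let `σ` be a morphism of split extensions which lifts along `q` and `q₁` to a regular
epimorphism `ρ : W ⟶ W₁`, compatibly with lifts of the kernels and sections. Then `ρ` restricts to
a regular epimorphism between the kernels of `q` and `q₁`. The reason is that the comparison of `W`
with the pullback of `q₁` and `σ` is a regular epimorphism: its image contains the kernel of `σ`,
which is itself a split extension, generated by the kernels of `f` and `g`. -/
theorem isRegularEpi_of_isSplitExtension {X S Y X₁ S₁ Y₁ W W₁ K K₁ : C}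
    {j : X ⟶ S} {p : S ⟶ Y} {i : Y ⟶ S} (h : IsSplitExtension j p i)
    {j₁ : X₁ ⟶ S₁} {p₁ : S₁ ⟶ Y₁} {i₁ : Y₁ ⟶ S₁} (h₁ : IsSplitExtension j₁ p₁ i₁)
    {f : X ⟶ X₁} {g : Y ⟶ Y₁} {σ : S ⟶ S₁} (hj : j ≫ σ = f ≫ j₁) (hi : i ≫ σ = g ≫ i₁)
    (hp : σ ≫ p₁ = p ≫ g) {l : X ⟶ W} {r : Y ⟶ W} {l₁ : X₁ ⟶ W₁} {r₁ : Y₁ ⟶ W₁}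
    {ρ : W ⟶ W₁} [IsRegularEpi ρ] (hl : l ≫ ρ = f ≫ l₁) (hr : r ≫ ρ = g ≫ r₁)
    {q : W ⟶ S} {q₁ : W₁ ⟶ S₁} (hlq : l ≫ q = j) (hrq : r ≫ q = i) (hq : q ≫ σ = ρ ≫ q₁)
    {k : K ⟶ W} (hk : IsKer k q) {k₁ : K₁ ⟶ W₁} (hk₁ : IsKer k₁ q₁) {u : K ⟶ K₁}
    (hu : u ≫ k₁ = k ≫ ρ) : IsRegularEpi u := by
  have := h.mono
  have := h₁.mono
  have := hk₁.mono
  -- The kernel of `σ` is a split extension of the kernel of `g` by the kernel of `f`.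
  let n := kernel.ι σ
  let jN : kernel f ⟶ kernel σ := kernel.lift σ (kernel.ι f ≫ j) (by
    rw [Category.assoc, hj, kernel.condition_assoc, zero_comp])
  let pN : kernel σ ⟶ kernel g := kernel.lift g (n ≫ p) (by
    rw [Category.assoc, ← hp, kernel.condition_assoc, zero_comp])
  let iN : kernel g ⟶ kernel σ := kernel.lift σ (kernel.ι g ≫ i) (by
    rw [Category.assoc, hi, kernel.condition_assoc, zero_comp])
  have hjN : jN ≫ n = kernel.ι f ≫ j := kernel.lift_ι _ _ _
  have hpN : pN ≫ kernel.ι g = n ≫ p := kernel.lift_ι _ _ _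
  have hiN : iN ≫ n = kernel.ι g ≫ i := kernel.lift_ι _ _ _
  have hN : IsSplitExtension jN pN iN :=
    { zero := by
        rw [← cancel_mono (kernel.ι g), Category.assoc, hpN, ← Category.assoc, hjN, Category.assoc,
          h.zero, comp_zero, zero_comp]
      mono := by
        have : Mono (jN ≫ n) := by rw [hjN]; infer_instance
        exact mono_of_mono jN n
      exists_lift := fun t ht => by
        obtain ⟨x, hx⟩ := h.exists_lift (t ≫ n) (by
          rw [Category.assoc, ← hpN, ← Category.assoc, ht, zero_comp])
        have hxf : x ≫ f = 0 := by
          rw [← cancel_mono j₁, Category.assoc, ← hj, ← Category.assoc, hx, Category.assoc,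
            kernel.condition, comp_zero, zero_comp]
        exact ⟨kernel.lift f x hxf, by
          rw [← cancel_mono n, Category.assoc, hjN, kernel.lift_ι_assoc, hx]⟩
      section_comp := by
        rw [← cancel_mono (kernel.ι g), Category.assoc, hpN, ← Category.assoc, hiN, Category.assoc,
          h.section_comp, Category.comp_id, Category.id_comp] }
  let c : W ⟶ pullback q₁ σ := pullback.lift ρ q hq.symm
  have : IsRegularEpi c := by
    obtain ⟨I, e, m, he, hm, fac⟩ := exists_regularEpi_mono c
    have : IsRegularEpi (m ≫ pullback.fst q₁ σ) := by
      have : StrongEpi (e ≫ m ≫ pullback.fst q₁ σ) := by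
        rw [← Category.assoc, fac, pullback.lift_fst]
        infer_instance
      have := strongEpi_of_strongEpi e (m ≫ pullback.fst q₁ σ)
      infer_instance
    let nP : kernel σ ⟶ pullback q₁ σ := pullback.lift 0 n (by rw [zero_comp, kernel.condition])
    have hnP : IsKer nP (pullback.fst q₁ σ) :=
      { zero := pullback.lift_fst _ _ _
        mono := by
          have : Mono (nP ≫ pullback.snd q₁ σ) := by rw [pullback.lift_snd]; infer_instance
          exact mono_of_mono nP (pullback.snd q₁ σ)
        exists_lift := fun t ht => by
          have ht' : (t ≫ pullback.snd q₁ σ) ≫ σ = 0 := by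
            rw [Category.assoc, ← pullback.condition, ← Category.assoc, ht, zero_comp]
          exact ⟨kernel.lift σ _ ht', by ext <;> simp [nP, ht, n]⟩ }
    have : IsIso (pullback.snd m nP) := hN.isIso_of_mono _
      (pullback.lift (kernel.ι f ≫ l ≫ e) jN (by
        rw [Category.assoc, Category.assoc, fac]
        ext <;> simp [c, nP, hl, hlq, hjN]))
      (pullback.lift (kernel.ι g ≫ r ≫ e) iN (by
        rw [Category.assoc, Category.assoc, fac]
        ext <;> simp [c, nP, hr, hrq, hiN]))
      (pullback.lift_snd _ _ _) (pullback.lift_snd _ _ _)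
    have : IsIso m := isIso_of_isKer_of_isRegularEpi hnP m (inv (pullback.snd m nP) ≫
      pullback.fst m nP) (by rw [Category.assoc, pullback.condition, IsIso.inv_hom_id_assoc])
    have : StrongEpi c := by rw [← fac]; infer_instance
    infer_instance
  have hK : IsKer (pullback.lift k₁ 0 (by rw [hk₁.zero, zero_comp])) (pullback.snd q₁ σ) :=
    { zero := pullback.lift_snd _ _ _
      mono := by
        have : Mono (pullback.lift k₁ 0 (by rw [hk₁.zero, zero_comp]) ≫ pullback.fst q₁ σ) := by
          rw [pullback.lift_fst]; infer_instance
        exact mono_of_mono _ (pullback.fst q₁ σ)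
      exists_lift := fun t ht => by
        obtain ⟨x, hx⟩ := hk₁.exists_lift (t ≫ pullback.fst q₁ σ) (by
          rw [Category.assoc, pullback.condition, ← Category.assoc, ht, zero_comp])
        exact ⟨x, by ext <;> simp [hx, ht]⟩ }
  exact isRegularEpi_of_isKer hk hK (f := c) (by ext <;> simp [c, hu, hk.zero])
    (pullback.lift_snd _ _ _)

end PreCrossed

/-! ### The Peiffer commutator -/

namespace PreCrossed

variable {C : Type u} [Category.{v} C] [HasZeroMorphisms C] [SemiAbelian C] {B : C}

section Join

lemma isKernel_iff {W S : PXMod B} {f : W ⟶ S} {K : Subobject W} :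
    IsKernel f K ↔ IsKer K.arrow.hom f.hom :=
  ⟨fun ⟨_, ⟨h⟩⟩ => .of_isLimit h, fun h => ⟨h.zero, h.nonempty_isLimit⟩⟩

/-- The kernel of a morphism is a subobject in pre-crossed modules. -/
lemma exists_isKernel {W S : PXMod B} (f : W ⟶ S) : ∃ K : Subobject W, IsKernel f K := by
  obtain ⟨K, k, hk⟩ := PXMod.exists_kernel f
  have := hk.mono
  have := PXMod.mono_of_mono_hom k
  refine ⟨Subobject.mk k, isKernel_iff.2 ⟨?_, inferInstance, fun t ht => ?_⟩⟩
  · rw [← Subobject.underlyingIso_hom_comp_eq_mk, PXMod.comp_hom, Category.assoc, hk.zero,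
      comp_zero]
  · obtain ⟨u, hu⟩ := hk.exists_lift t ht
    refine ⟨u ≫ (Subobject.underlyingIso k).inv.hom, ?_⟩
    rw [Category.assoc, ← PXMod.comp_hom, Subobject.underlyingIso_arrow, hu]

/-- The join of two subobjects exists: it is the image of their coproduct. -/
lemma exists_isLUB {W : PXMod B} (K K' : Subobject W) : ∃ D : Subobject W, IsLUB {K, K'} D ∧
    ∃ e : (K : PXMod B) ⨿ (K' : PXMod B) ⟶ D, IsRegularEpi e.hom ∧
      e ≫ D.arrow = coprod.desc K.arrow K'.arrow := by
  obtain ⟨I, e, m, he, hm, fac⟩ := PXMod.exists_image (coprod.desc K.arrow K'.arrow)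
  have := PXMod.isRegularEpi_of_hom e
  refine ⟨Subobject.mk m, ⟨?_, fun M hM => ?_⟩, e ≫ (Subobject.underlyingIso m).inv, ?_, ?_⟩
  · rintro M (rfl | rfl)
    · exact Subobject.le_mk_of_comm (coprod.inl ≫ e) (by simp [fac])
    · exact Subobject.le_mk_of_comm (coprod.inr ≫ e) (by simp [fac])
  · have sq : CommSq (coprod.desc (Subobject.ofLE K M (hM (by simp)))
        (Subobject.ofLE K' M (hM (by simp)))) e M.arrow m := ⟨by
      rw [fac]
      ext1 <;> simp⟩
    exact Subobject.mk_le_of_comm sq.lift sq.fac_right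
  · infer_instance
  · rw [Category.assoc, Subobject.underlyingIso_arrow, fac]

/-- A morphism out of a join factors through a subobject if its restrictions do. -/
lemma exists_lift_of_isLUB {W V M : PXMod B} {K K' D : Subobject W} (hD : IsLUB {K, K'} D)
    (ρ : W ⟶ V) (m : M ⟶ V) [Mono m] (a : (K : PXMod B) ⟶ M) (ha : a ≫ m = K.arrow ≫ ρ)
    (b : (K' : PXMod B) ⟶ M) (hb : b ≫ m = K'.arrow ≫ ρ) :
    ∃ d : (D : PXMod B) ⟶ M, d ≫ m = D.arrow ≫ ρ := by
  obtain ⟨D', hD', e, he, fac⟩ := exists_isLUB K K'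
  obtain rfl := hD.unique hD'
  have := PXMod.isRegularEpi_of_hom e
  have sq : CommSq (coprod.desc a b) e m (D.arrow ≫ ρ) := ⟨by
    rw [← Category.assoc, fac]
    ext1 <;> simp [ha, hb]⟩
  exact ⟨sq.lift, sq.fac_right⟩

/-- If `ρ` maps two subobjects onto `K₁` and `K₁'`, then it maps their join onto the join of `K₁`
and `K₁'`. -/
lemma strongEpi_of_isLUB {W W₁ : PXMod B} {K K' D : Subobject W} (hD : IsLUB {K, K'} D)
    {K₁ K₁' D₁ : Subobject W₁} (hD₁ : IsLUB {K₁, K₁'} D₁) {ρ : W ⟶ W₁}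
    (a : (K : PXMod B) ⟶ K₁) [StrongEpi a] (ha : a ≫ K₁.arrow = K.arrow ≫ ρ)
    (b : (K' : PXMod B) ⟶ K₁') [StrongEpi b] (hb : b ≫ K₁'.arrow = K'.arrow ≫ ρ)
    (d : (D : PXMod B) ⟶ D₁) (hd : d ≫ D₁.arrow = D.arrow ≫ ρ) : StrongEpi d := by
  obtain ⟨M, e, m, he, hm, rfl⟩ := PXMod.exists_image d
  have := PXMod.isRegularEpi_of_hom e
  have hM : ∀ {L : Subobject W} {L₁ : Subobject W₁} (c : (L : PXMod B) ⟶ L₁) [StrongEpi c]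
      (_ : c ≫ L₁.arrow = L.arrow ≫ ρ) (_ : L ≤ D), L₁ ≤ Subobject.mk (m ≫ D₁.arrow) := by
    intro L L₁ c _ hc hLD
    have sq : CommSq (Subobject.ofLE L D hLD ≫ e) c (m ≫ D₁.arrow) L₁.arrow := ⟨by
      rw [hc, Category.assoc, ← Category.assoc e, hd, Subobject.ofLE_arrow_assoc]⟩
    exact Subobject.le_mk_of_comm sq.lift sq.fac_right
  have hle : D₁ ≤ Subobject.mk (m ≫ D₁.arrow) := hD₁.2 (by
    rintro L₁ (rfl | rfl)
    · exact hM a ha (hD.1 (by simp))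
    · exact hM b hb (hD.1 (by simp)))
  have hs : Subobject.ofLEMk D₁ _ hle ≫ m = 𝟙 _ := by
    rw [← cancel_mono D₁.arrow, Category.assoc, Subobject.ofLEMk_comp, Category.id_comp]
  have : IsSplitEpi m := ⟨⟨⟨_, hs⟩⟩⟩
  infer_instance

end Join

section Commutator

variable {X Y W X₁ Y₁ W₁ : PXMod B} {inl : X ⟶ W} {inr : Y ⟶ W} {inl₁ : X₁ ⟶ W₁} {inr₁ : Y₁ ⟶ W₁}

/-- The morphism `[m, n]` out of a coproduct. -/
def copair (hW : IsColimit (BinaryCofan.mk inl inr)) {Z : PXMod B} (m : X ⟶ Z) (n : Y ⟶ Z) :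
    W ⟶ Z := hW.desc (BinaryCofan.mk m n)

lemma inl_copair (hW : IsColimit (BinaryCofan.mk inl inr)) {Z : PXMod B} (m : X ⟶ Z) (n : Y ⟶ Z) :
    inl ≫ copair hW m n = m := hW.fac _ ⟨.left⟩

lemma inr_copair (hW : IsColimit (BinaryCofan.mk inl inr)) {Z : PXMod B} (m : X ⟶ Z) (n : Y ⟶ Z) :
    inr ≫ copair hW m n = n := hW.fac _ ⟨.right⟩

lemma hom_ext_of_isColimit (hW : IsColimit (BinaryCofan.mk inl inr)) {Z : PXMod B} {f g : W ⟶ Z}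
    (hl : inl ≫ f = inl ≫ g) (hr : inr ≫ f = inr ≫ g) : f = g :=
  BinaryCofan.IsColimit.hom_ext hW hl hr

lemma copair_naturality (hW : IsColimit (BinaryCofan.mk inl inr))
    (hW₁ : IsColimit (BinaryCofan.mk inl₁ inr₁)) {f : X ⟶ X₁} {g : Y ⟶ Y₁} {ρ : W ⟶ W₁}
    (hl : inl ≫ ρ = f ≫ inl₁) (hr : inr ≫ ρ = g ≫ inr₁) {Z Z₁ : PXMod B} {m : X ⟶ Z} {n : Y ⟶ Z}
    {m₁ : X₁ ⟶ Z₁} {n₁ : Y₁ ⟶ Z₁} {h : Z ⟶ Z₁} (hm : m ≫ h = f ≫ m₁) (hn : n ≫ h = g ≫ n₁) :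
    copair hW m n ≫ h = ρ ≫ copair hW₁ m₁ n₁ := hom_ext_of_isColimit hW
  (by rw [← Category.assoc, inl_copair, hm, ← Category.assoc, hl, Category.assoc, inl_copair])
  (by rw [← Category.assoc, inr_copair, hn, ← Category.assoc, hr, Category.assoc, inr_copair])

/-- The coproduct of two strong epimorphisms is a strong epimorphism. -/
lemma strongEpi_coproduct (hW₁ : IsColimit (BinaryCofan.mk inl₁ inr₁)) {f : X ⟶ X₁} {g : Y ⟶ Y₁}
    [StrongEpi f] [StrongEpi g] {ρ : W ⟶ W₁} (hl : inl ≫ ρ = f ≫ inl₁) (hr : inr ≫ ρ = g ≫ inr₁) :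
    StrongEpi ρ := by
  obtain ⟨M, e, m, he, hm, rfl⟩ := PXMod.exists_image ρ
  have := PXMod.isRegularEpi_of_hom e
  have sq₁ : CommSq (inl ≫ e) f m inl₁ := ⟨by rw [Category.assoc, hl]⟩
  have sq₂ : CommSq (inr ≫ e) g m inr₁ := ⟨by rw [Category.assoc, hr]⟩
  have hs : copair hW₁ sq₁.lift sq₂.lift ≫ m = 𝟙 _ := hom_ext_of_isColimit hW₁
    (by rw [← Category.assoc, inl_copair, sq₁.fac_right, Category.comp_id])
    (by rw [← Category.assoc, inr_copair, sq₂.fac_right, Category.comp_id])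
  have : IsSplitEpi m := ⟨⟨⟨_, hs⟩⟩⟩
  infer_instance

/-- Kernels of morphisms to semidirect products are functorial, and preserve regular
epimorphisms. -/
lemma exists_kernel_map {S S₁ : PXMod B} {j : X ⟶ S} {i : Y ⟶ S} {j₁ : X₁ ⟶ S₁} {i₁ : Y₁ ⟶ S₁}
    {p : S.obj ⟶ Y.obj} {p₁ : S₁.obj ⟶ Y₁.obj} (h : IsSplitExtension j.hom p i.hom)
    (h₁ : IsSplitExtension j₁.hom p₁ i₁.hom) {f : X ⟶ X₁} {g : Y ⟶ Y₁} {σ : S ⟶ S₁}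
    (hσj : j ≫ σ = f ≫ j₁) (hσi : i ≫ σ = g ≫ i₁) (hσp : σ.hom ≫ p₁ = p ≫ g.hom)
    {ρ : W ⟶ W₁} (hl : inl ≫ ρ = f ≫ inl₁) (hr : inr ≫ ρ = g ≫ inr₁) {q : W ⟶ S} {q₁ : W₁ ⟶ S₁}
    (hlq : inl ≫ q = j) (hrq : inr ≫ q = i) (hq : q ≫ σ = ρ ≫ q₁) {K : Subobject W}
    (hK : IsKernel q K) {K₁ : Subobject W₁} (hK₁ : IsKernel q₁ K₁) :
    ∃ u : (K : PXMod B) ⟶ K₁, u ≫ K₁.arrow = K.arrow ≫ ρ ∧ (StrongEpi ρ → StrongEpi u) := by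
  rw [isKernel_iff] at hK hK₁
  obtain ⟨u, hu⟩ := hK₁.exists_lift (K.arrow.hom ≫ ρ.hom) (by
    rw [Category.assoc, ← PXMod.comp_hom, ← hq, PXMod.comp_hom, ← Category.assoc, hK.zero,
      zero_comp])
  have := hK₁.mono
  obtain ⟨v, rfl, hv⟩ := PXMod.exists_hom_of_comp_mono K₁.arrow (K.arrow ≫ ρ) u hu
  refine ⟨v, hv, fun _ => ?_⟩
  have : IsRegularEpi v.hom := isRegularEpi_of_isSplitExtension h h₁ (congrArg PXMod.Hom.hom hσj)
    (congrArg PXMod.Hom.hom hσi) hσp (congrArg PXMod.Hom.hom hl) (congrArg PXMod.Hom.hom hr)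
    (congrArg PXMod.Hom.hom hlq) (congrArg PXMod.Hom.hom hrq) (congrArg PXMod.Hom.hom hq) hK hK₁ hu
  have := PXMod.isRegularEpi_of_hom v
  infer_instance

/-- The objects `X ⋄ Y` are functorial, and preserve regular epimorphisms. -/
lemma IsPeifferJoin.exists_map {hW : IsColimit (BinaryCofan.mk inl inr)}
    {hW₁ : IsColimit (BinaryCofan.mk inl₁ inr₁)} {D : Subobject W} {D₁ : Subobject W₁}
    (hD : IsPeifferJoin hW D) (hD₁ : IsPeifferJoin hW₁ D₁) {f : X ⟶ X₁} {g : Y ⟶ Y₁} {ρ : W ⟶ W₁}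
    (hl : inl ≫ ρ = f ≫ inl₁) (hr : inr ≫ ρ = g ≫ inr₁) :
    ∃ d : (D : PXMod B) ⟶ D₁, d ≫ D₁.arrow = D.arrow ≫ ρ ∧
      (StrongEpi f → StrongEpi g → StrongEpi d) := by
  obtain ⟨S, S', K, K', hK, hK', hKD⟩ := hD
  obtain ⟨S₁, S₁', K₁, K₁', hK₁, hK₁', hKD₁⟩ := hD₁
  obtain ⟨σ, hσj, hσi, hσp⟩ := S.exists_map S₁ f g
  obtain ⟨σ', hσj', hσi', hσp'⟩ := S'.exists_map S₁' g f
  obtain ⟨a, ha, ha'⟩ := exists_kernel_map S.isSplitExtension S₁.isSplitExtension hσj hσi hσp hl hr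
    (inl_copair _ _ _) (inr_copair _ _ _)
    (copair_naturality hW hW₁ hl hr hσj hσi) hK hK₁
  obtain ⟨b, hb, hb'⟩ := exists_kernel_map S'.isSplitExtension S₁'.isSplitExtension hσj' hσi' hσp'
    hr hl (inr_copair _ _ _) (inl_copair _ _ _)
    (copair_naturality hW hW₁ hl hr hσi' hσj') hK' hK₁'
  obtain ⟨d, hd⟩ := exists_lift_of_isLUB hKD ρ D₁.arrow
    (a ≫ Subobject.ofLE _ _ (hKD₁.1 (by simp))) (by simp [ha])
    (b ≫ Subobject.ofLE _ _ (hKD₁.1 (by simp))) (by simp [hb])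
  refine ⟨d, hd, fun _ _ => ?_⟩
  have hρ := strongEpi_coproduct hW₁ hl hr
  have := ha' hρ
  have := hb' hρ
  exact strongEpi_of_isLUB hKD hKD₁ a ha b hb d hd

/-- The kernel of `δ` is a pre-crossed module; it contains the kernels of both morphisms to the
semidirect products, hence their join. -/
lemma IsPeifferJoin.δ_eq_zero {hW : IsColimit (BinaryCofan.mk inl inr)} {D : Subobject W}
    (hD : IsPeifferJoin hW D) : (D : PXMod B).δ = 0 := by
  obtain ⟨S, S', K, K', hK, hK', hKD⟩ := hD
  replace hK : IsKer K.arrow.hom (copair hW S.j S.i).hom := isKernel_iff.1 hK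
  replace hK' : IsKer K'.arrow.hom (copair hW S'.i S'.j).hom := isKernel_iff.1 hK'
  obtain ⟨L, k, hk⟩ := PXMod.exists_kernel W.toSelf
  have := hk.mono
  have := PXMod.mono_of_mono_hom k
  have key : ∀ {V : PXMod B} {M : Subobject W} (q : W ⟶ V), IsKer M.arrow.hom q.hom →
      ∃ a : (M : PXMod B) ⟶ L, a ≫ k = M.arrow ≫ 𝟙 W := by
    intro V M q hM
    obtain ⟨u, hu⟩ := hk.exists_lift M.arrow.hom (by
      change _ ≫ W.δ = 0
      rw [← q.hom_δ, ← Category.assoc, hM.zero, zero_comp])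
    obtain ⟨a, -, ha⟩ := PXMod.exists_hom_of_comp_mono k M.arrow u hu
    exact ⟨a, by rw [ha, Category.comp_id]⟩
  obtain ⟨a, ha⟩ := key _ hK
  obtain ⟨b, hb⟩ := key _ hK'
  obtain ⟨d, hd⟩ := exists_lift_of_isLUB hKD (𝟙 W) k a ha b hb
  rw [Category.comp_id] at hd
  rw [← D.arrow.hom_δ, ← hd, PXMod.comp_hom, Category.assoc]
  exact (d.hom ≫= hk.zero).trans comp_zero

variable {A A₁ : PXMod B}

/-- The Peiffer commutator is functorial, and preserves regular epimorphisms. -/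
theorem IsPeifferCommutator.exists_map {m : X ⟶ A} {n : Y ⟶ A} {m₁ : X₁ ⟶ A₁} {n₁ : Y₁ ⟶ A₁}
    {Q : Subobject A} {Q₁ : Subobject A₁} (hQ : IsPeifferCommutator m n Q)
    (hQ₁ : IsPeifferCommutator m₁ n₁ Q₁) {f : X ⟶ X₁} {g : Y ⟶ Y₁} {h : A ⟶ A₁}
    (hm : m ≫ h = f ≫ m₁) (hn : n ≫ h = g ≫ n₁) :
    ∃ φ : (Q : PXMod B) ⟶ Q₁, φ ≫ Q₁.arrow = Q.arrow ≫ h ∧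
      (StrongEpi f → StrongEpi g → IsRegularEpi φ) := by
  obtain ⟨W, inl, inr, hW, D, r, hD, hr, fac⟩ := hQ
  obtain ⟨W₁, inl₁, inr₁, hW₁, D₁, r₁, hD₁, hr₁, fac₁⟩ := hQ₁
  replace fac : r ≫ Q.arrow = D.arrow ≫ copair hW m n := fac
  replace fac₁ : r₁ ≫ Q₁.arrow = D₁.arrow ≫ copair hW₁ m₁ n₁ := fac₁
  obtain ⟨d, hd, hd'⟩ := hD.exists_map hD₁ (f := f) (g := g)
    (ρ := copair hW (f ≫ inl₁) (g ≫ inr₁)) (inl_copair _ _ _) (inr_copair _ _ _)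
  have hρ := copair_naturality hW hW₁ (ρ := copair hW (f ≫ inl₁) (g ≫ inr₁)) (inl_copair _ _ _)
    (inr_copair _ _ _) hm hn
  have sq : CommSq (d ≫ r₁) r Q₁.arrow (Q.arrow ≫ h) := ⟨by
    rw [Category.assoc, fac₁, ← Category.assoc, hd, Category.assoc, ← hρ, ← Category.assoc, ← fac,
      Category.assoc]⟩
  refine ⟨sq.lift, sq.fac_right, fun hf hg => ?_⟩
  have := hd' hf hg
  have : StrongEpi (r ≫ sq.lift) := by
    rw [sq.fac_left]
    infer_instance
  have := strongEpi_of_strongEpi r sq.lift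
  exact PXMod.isRegularEpi_of_hom _

theorem exists_isPeifferCommutator (m : X ⟶ A) (n : Y ⟶ A) :
    ∃ Q : Subobject A, IsPeifferCommutator m n Q := by
  have hW : IsColimit (BinaryCofan.mk (coprod.inl : X ⟶ X ⨿ Y) coprod.inr) := coprodIsCoprod X Y
  obtain ⟨S, -⟩ := exists_semidirectProduct X Y
  obtain ⟨S', -⟩ := exists_semidirectProduct Y X
  obtain ⟨K, hK⟩ := exists_isKernel (copair hW S.j S.i)
  obtain ⟨K', hK'⟩ := exists_isKernel (copair hW S'.i S'.j)
  obtain ⟨D, hD, -⟩ := exists_isLUB K K'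
  obtain ⟨I, e, i, he, hi, fac⟩ := PXMod.exists_image (D.arrow ≫ copair hW m n)
  have := PXMod.isRegularEpi_of_hom e
  have : Mono i := hi
  refine ⟨Subobject.mk i, _, _, _, hW, D, e ≫ (Subobject.underlyingIso i).inv,
    ⟨S, S', K, K', hK, hK', hD⟩, PXMod.isRegularEpi_of_hom _, ?_⟩
  rw [Category.assoc, Subobject.underlyingIso_arrow, fac]
  rfl

lemma IsPeifferCommutator.le {m : X ⟶ A} {n : Y ⟶ A} {m₁ : X₁ ⟶ A} {n₁ : Y₁ ⟶ A}
    {Q Q₁ : Subobject A} (hQ : IsPeifferCommutator m n Q) (hQ₁ : IsPeifferCommutator m₁ n₁ Q₁)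
    {f : X ⟶ X₁} {g : Y ⟶ Y₁} (hm : f ≫ m₁ = m) (hn : g ≫ n₁ = n) : Q ≤ Q₁ := by
  obtain ⟨φ, hφ, -⟩ := hQ.exists_map hQ₁ (f := f) (g := g) (h := 𝟙 A) (by simp [hm]) (by simp [hn])
  exact Subobject.le_of_comm φ (by rw [hφ, Category.comp_id])

/-- A Peiffer commutator lies in the kernel of `δ`, so that it has a morphism to the initial
object. -/
lemma IsPeifferCommutator.δ_eq_zero {m : X ⟶ A} {n : Y ⟶ A} {Q : Subobject A}
    (hQ : IsPeifferCommutator m n Q) : (Q : PXMod B).δ = 0 := by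
  obtain ⟨W, inl, inr, hW, D, r, hD, hr, -⟩ := hQ
  rw [← cancel_epi r.hom, r.hom_δ, hD.δ_eq_zero, comp_zero]

end Commutator

end PreCrossed

end

theorem mainTheorem8 {C : Type u} [Category.{v} C] [HasZeroMorphisms C] [SemiAbelian C] (B : C) :
    -- (regular epi, mono) factorizations exist, and Peiffer commutators exist and are unique
    (∀ (X Y : PreCrossed.PXMod B) (f : X ⟶ Y),
      ∃ (I : PreCrossed.PXMod B) (e : X ⟶ I) (i : I ⟶ Y), PreCrossed.IsImageFactorization f e i) ∧
    (∀ (X Y A : PreCrossed.PXMod B) (m : X ⟶ A) (n : Y ⟶ A), Mono m → Mono n →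
      ∃! Q : Subobject A, PreCrossed.IsPeifferCommutator m n Q) ∧
    -- preservation of the factorization
    (∀ (X Y A X' Y' A' : PreCrossed.PXMod B) (m : X ⟶ A) (n : Y ⟶ A) (m' : X' ⟶ A') (n' : Y' ⟶ A')
      (f : X ⟶ X') (g : Y ⟶ Y') (h : A ⟶ A'),
      Mono m → Mono n → Mono m' → Mono n' → m ≫ h = f ≫ m' → n ≫ h = g ≫ n' →
      ∀ (fX gY : PreCrossed.PXMod B) (e₁ : X ⟶ fX) (i₁ : fX ⟶ X') (e₂ : Y ⟶ gY) (i₂ : gY ⟶ Y'),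
      PreCrossed.IsImageFactorization f e₁ i₁ → PreCrossed.IsImageFactorization g e₂ i₂ →
      ∀ (Q : Subobject A) (Q' R : Subobject A'),
      PreCrossed.IsPeifferCommutator m n Q → PreCrossed.IsPeifferCommutator m' n' Q' →
      PreCrossed.IsPeifferCommutator (i₁ ≫ m') (i₂ ≫ n') R →
      ∃ φ : (Q : PreCrossed.PXMod B) ⟶ (Q' : PreCrossed.PXMod B),
        φ ≫ Q'.arrow = Q.arrow ≫ h ∧
        ∃ (e : (Q : PreCrossed.PXMod B) ⟶ (R : PreCrossed.PXMod B))
          (i : (R : PreCrossed.PXMod B) ⟶ (Q' : PreCrossed.PXMod B)),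
          PreCrossed.IsImageFactorization φ e i ∧ i ≫ Q'.arrow = R.arrow) ∧
    -- monotonicity
    (∀ (A : PreCrossed.PXMod B) (X X' Y Y' Q Q' : Subobject A), X ≤ X' → Y ≤ Y' →
      PreCrossed.IsPeifferCommutator X.arrow Y.arrow Q →
      PreCrossed.IsPeifferCommutator X'.arrow Y'.arrow Q' → Q ≤ Q') ∧
    -- the cokernel of the Peiffer commutator exists and kills the commutator of the images
    (∀ (X Y A : PreCrossed.PXMod B) (m : X ⟶ A) (n : Y ⟶ A) (Q : Subobject A), Mono m → Mono n →
      PreCrossed.IsPeifferCommutator m n Q →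
      (∃ (E : PreCrossed.PXMod B) (q : A ⟶ E), PreCrossed.IsCokernel Q.arrow q) ∧
      ∀ (E : PreCrossed.PXMod B) (q : A ⟶ E), PreCrossed.IsCokernel Q.arrow q →
        ∀ (qX qY : PreCrossed.PXMod B) (e₁ : X ⟶ qX) (i₁ : qX ⟶ E) (e₂ : Y ⟶ qY) (i₂ : qY ⟶ E),
        PreCrossed.IsImageFactorization (m ≫ q) e₁ i₁ →
        PreCrossed.IsImageFactorization (n ≫ q) e₂ i₂ →
        ∀ R : Subobject E, PreCrossed.IsPeifferCommutator i₁ i₂ R →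
          IsZero (R : PreCrossed.PXMod B).obj) := by
  open PreCrossed in
  refine ⟨fun X Y f => ?_, fun X Y A m n _ _ => ?_, ?_, ?_, fun X Y A m n Q _ _ hQ => ⟨?_, ?_⟩⟩
  · obtain ⟨I, e, i, he, hi, fac⟩ := PXMod.exists_image f
    exact ⟨I, e, i, PXMod.isRegularEpi_of_hom e, hi, fac⟩
  · obtain ⟨Q, hQ⟩ := exists_isPeifferCommutator m n
    exact ⟨Q, hQ, fun Q' hQ' => le_antisymm (hQ'.le hQ (Category.id_comp m) (Category.id_comp n))
      (hQ.le hQ' (Category.id_comp m) (Category.id_comp n))⟩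
  -- The morphism is built as its own factorization, through the commutator of the images.
  · intro X Y A X' Y' A' m n m' n' f g h _ _ _ _ hm hn fX gY e₁ i₁ e₂ i₂ hf hg Q Q' R hQ hQ' hR
    have := hf.regularEpi
    have := hg.regularEpi
    obtain ⟨e, he, he'⟩ := hQ.exists_map hR (f := e₁) (g := e₂) (h := h)
      (by rw [hm, ← hf.fac, Category.assoc]) (by rw [hn, ← hg.fac, Category.assoc])
    have hle : R ≤ Q' := hR.le hQ' (f := i₁) (g := i₂) rfl rfl
    exact ⟨e ≫ Subobject.ofLE R Q' hle, by rw [Category.assoc, Subobject.ofLE_arrow, he], e,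
      Subobject.ofLE R Q' hle, ⟨he' inferInstance inferInstance, inferInstance, rfl⟩,
      Subobject.ofLE_arrow _⟩
  · intro A X X' Y Y' Q Q' hX hY hQ hQ'
    exact hQ.le hQ' (Subobject.ofLE_arrow hX) (Subobject.ofLE_arrow hY)
  · exact ⟨_, pushout.inl _ _, _, PXMod.isInitialZero B, PXMod.zeroHom hQ.δ_eq_zero, pushout.inr _ _,
      IsPushout.of_hasPushout _ _⟩
  -- The commutator maps onto that of the images in `E`, and its composite with `q` is zero.
  · rintro E q ⟨Z, hZ, t, z, hq⟩ qX qY e₁ i₁ e₂ i₂ h₁ h₂ R hR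
    have := h₁.regularEpi
    have := h₂.regularEpi
    obtain ⟨φ, hφ, hφ'⟩ := hQ.exists_map hR h₁.fac.symm h₂.fac.symm
    have := hφ' inferInstance inferInstance
    have hz : φ.hom ≫ R.arrow.hom = 0 := by
      rw [← PXMod.comp_hom, hφ, hq.w, PXMod.comp_hom,
        (PXMod.isZero_of_isInitial hZ).eq_of_tgt t.hom 0, zero_comp]
    exact IsZero.of_mono_eq_zero R.arrow.hom ((cancel_epi φ.hom).1 (hz.trans comp_zero.symm))
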